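/- Let $X$ be a metric space and let $\underline A=(A,|\cdot|)$ be a pseudo-normed abelian group: $|\cdot|\colon A\to\mathbb R_{\ge 0}$ satisfies $|0|=0$, $|a+b|\le|a|+|b|$ and $|-a|=|a|$. Every subset of $X$ carries the restricted metric. A family $\{\sigma_i\colon\Delta^n\to X\}_{i\in I}$ of singular $n$-simplices is \emph{uniform} if it is equicontinuous and for every $r>0$ there is $K_r\ge 0$ such that for every $x\in X$ the ball $B_r(x)$ meets the image of $\sigma_i$ for at most $K_r$ indices $i$. The cochain complex $C^*_{\mathrm{ub}}(X;\underline A)$ consists of the singular cochains $u$ with values in $A$ such that $\sup_{i}|u(\sigma_i)|<\infty$ for every uniform family $\{\sigma_i\}_{i\in I}$, with the usual coboundary; $H^*_{\mathrm{ub}}(X;\underline A)$ is its cohomology. For $Y\subset X$, $H^*_{\mathrm{ub}}(X,Y;\underline A)$ is the cohomology of the kernel of the restriction $C^*_{\mathrm{ub}}(X;\underline A)\to C^*_{\mathrm{ub}}(Y;\underline A)$. The chain complex $C_*^{\mathrm{ub}}(X;\underline A)$ consists of the possibly infinite formal sums $\sum_{i\in I}a_i\sigma_i$ with $\{\sigma_i\}_{i\in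 I}$ a uniform family and $\sup_i|a_i|<\infty$, with the usual boundary; $H_*^{\mathrm{ub}}(X;\underline A)$ is its homology, and $H_*^{\mathrm{ub}}(X,Y;\underline A)$ is the homology of $C_*^{\mathrm{ub}}(X;\underline A)/C_*^{\mathrm{ub}}(Y;\underline A)$. \begin{enumerate} \item \textbf{(Mayer--Vietoris.)} Let $X=U\cup V$ and $\epsilon>0$ be such that every subset of $X$ of diameter less than $\epsilon$ is contained in $U$ or in $V$. Let $i_U\colon U\to X$, $i_V\colon V\to X$, $j_U\colon U\cap V\to U$, $j_V\colon U\cap V\to V$ be the inclusions. Then there are homomorphisms $H^n_{\mathrm{ub}}(U\cap V;\underline A)\to H^{n+1}_{\mathrm{ub}}(X;\underline A)$ and $H_{n+1}^{\mathrm{ub}}(X;\underline A)\to H_n^{\mathrm{ub}}(U\cap V;\underline A)$, $n\ge 0$, such that the sequences \[ 0\to H^0_{\mathrm{ub}}(X;\underline A)\to\cdots\to H^n_{\mathrm{ub}}(X;\underline A)\xrightarrow{(i_U^*,i_V^*)}H^n_{\mathrm{ub}}(U;\underline A)\oplus H^n_{\mathrm{ub}}(V;\underline A)\xrightarrow{j_U^*-j_V^*}H^n_{\mathrm{ub}}(U\cap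 V;\underline A)\to H^{n+1}_{\mathrm{ub}}(X;\underline A)\to\cdots \] and \[ \cdots\to H_{n+1}^{\mathrm{ub}}(X;\underline A)\to H_n^{\mathrm{ub}}(U\cap V;\underline A)\xrightarrow{((j_U)_*,(j_V)_*)}H_n^{\mathrm{ub}}(U;\underline A)\oplus H_n^{\mathrm{ub}}(V;\underline A)\xrightarrow{(i_U)_*-(i_V)_*}H_n^{\mathrm{ub}}(X;\underline A)\to\cdots\to H_0^{\mathrm{ub}}(X;\underline A)\to 0 \] are exact. \item \textbf{(Excision.)} Let $Z\subset Y\subset X$ be such that for some $\epsilon>0$ the open $\epsilon$-neighbourhood $B_\epsilon(Z)$ is contained in $Y$. Then for every $n\ge 0$ the maps \[ H^n_{\mathrm{ub}}(X,Y;\underline A)\to H^n_{\mathrm{ub}}(X-Z,Y-Z;\underline A),\qquad H_n^{\mathrm{ub}}(X-Z,Y-Z;\underline A)\to H_n^{\mathrm{ub}}(X,Y;\underline A) \] induced by the inclusion are isomorphisms. \end{enumerate} -/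

import Mathlib

universe u v

noncomputable section

namespace UniformBounded

open CategoryTheory CategoryTheory.Limits Set

/-! ### Singular simplices and uniform families -/

/-- A singular `n`-simplex in `X`: a continuous map from the standard `n`-simplex. -/
abbrev Simplex (n : ℕ) (X : Type u) [TopologicalSpace X] : Type u :=
  C(stdSimplex ℝ (Fin (n + 1)), X)

/-- The `j`-th face of a singular simplex. -/
def face {n : ℕ} {X : Type u} [TopologicalSpace X] (j : Fin (n + 2)) (σ : Simplex (n + 1) X) :
    Simplex n X :=
  σ.comp ⟨stdSimplex.map j.succAbove, stdSimplex.continuous_map _⟩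

/-- A family of singular simplices is uniform if it is equicontinuous and, for every `r > 0`,
there is a bound `K` such that every ball of radius `r` meets at most `K` members of the family
(counted with their indices). -/
structure IsUniformFamily {n : ℕ} {X : Type u} [MetricSpace X] {ι : Type*}
    (σ : ι → Simplex n X) : Prop where
  locallyFinite : ∀ r : ℝ, 0 < r → ∃ K : ℕ, ∀ x : X,
    {i : ι | (Metric.ball x r ∩ range (σ i)).Nonempty}.encard ≤ K
  equicontinuous : Equicontinuous fun i => (σ i : stdSimplex ℝ (Fin (n + 1)) → X)

/-- A map between metric spaces is effectively proper if for every `r > 0` there is `s > 0` such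
that points with images at distance `< r` have distance `< s`. -/
def EffectivelyProper {X Y : Type u} [MetricSpace X] [MetricSpace Y] (f : X → Y) : Prop :=
  ∀ r : ℝ, 0 < r → ∃ s : ℝ, 0 < s ∧ ∀ x y : X, dist (f x) (f y) < r → dist x y < s

/-- Effectively proper uniformly continuous maps. -/
structure EPUC (X Y : Type u) [MetricSpace X] [MetricSpace Y] where
  /-- the underlying map -/
  toFun : X → Y
  uniformContinuous : UniformContinuous toFun
  effectivelyProper : EffectivelyProper toFun

namespace EPUC

variable {X Y : Type u} [MetricSpace X] [MetricSpace Y]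

/-- An isometry is effectively proper and uniformly continuous. -/
def ofIsometry (f : X → Y) (hf : Isometry f) : EPUC X Y where
  toFun := f
  uniformContinuous := hf.uniformContinuous
  effectivelyProper r hr := ⟨r, hr, fun x y h => by rwa [hf.dist_eq] at h⟩

/-- The inclusion of a subspace. -/
def subspace (S : Set X) : EPUC S X :=
  ofIsometry Subtype.val isometry_subtype_coe

/-- The inclusion between two nested subspaces. -/
def inclusion {S T : Set X} (h : S ⊆ T) : EPUC S T :=
  ofIsometry (Set.inclusion h) fun _ _ => rfl

/-- A map of pairs `(X, S) → (Y, T)` restricted to a map `S → T`. -/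
def restrict (f : EPUC X Y) {S : Set X} {T : Set Y} (h : MapsTo f.toFun S T) : EPUC S T where
  toFun := h.restrict f.toFun S T
  uniformContinuous :=
    (f.uniformContinuous.comp uniformContinuous_subtype_val).subtype_mk _
  effectivelyProper r hr := by
    obtain ⟨s, hs, H⟩ := f.effectivelyProper r hr
    exact ⟨s, hs, fun x y hxy => H x y hxy⟩

/-- The map on singular simplices, `σ ↦ f ∘ σ`. -/
def mapSimplex (f : EPUC X Y) (n : ℕ) (σ : Simplex n X) : Simplex n Y :=
  (⟨f.toFun, f.uniformContinuous.continuous⟩ : C(X, Y)).comp σ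

theorem face_mapSimplex (f : EPUC X Y) {n : ℕ} (j : Fin (n + 2)) (σ : Simplex (n + 1) X) :
    face j (f.mapSimplex (n + 1) σ) = f.mapSimplex n (face j σ) := rfl

end EPUC

theorem face_face {n : ℕ} {X : Type u} [TopologicalSpace X] (σ : Simplex (n + 2) X)
    {i j : Fin (n + 2)} (h : i ≤ j) :
    face i (face j.succ σ) = face j (face i.castSucc σ) := by
  ext x
  simp only [face, ContinuousMap.comp_apply, ContinuousMap.coe_mk, stdSimplex.map_comp_apply]
  congr 2
  ext k
  have := congrArg (fun f : SimplexCategory.mk n ⟶ SimplexCategory.mk (n + 2) =>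
    (f.toOrderHom k).val) (SimplexCategory.δ_comp_δ h)
  simpa [SimplexCategory.δ] using this

namespace IsUniformFamily

variable {m n : ℕ} {X Y : Type u} [MetricSpace X] [MetricSpace Y]

/-- Reindexing along an injective map. -/
theorem comp_injective {ι κ : Type*} {σ : ι → Simplex n X} (h : IsUniformFamily σ)
    {g : κ → ι} (hg : Function.Injective g) : IsUniformFamily (σ ∘ g) where
  locallyFinite r hr := by
    obtain ⟨K, hK⟩ := h.locallyFinite r hr
    refine ⟨K, fun x => le_trans ?_ (hK x)⟩
    rw [← hg.encard_image]
    apply encard_le_encard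
    rintro _ ⟨i, hi, rfl⟩
    exact hi
  equicontinuous x U hU := (h.equicontinuous x U hU).mono fun _ hy i => hy (g i)

/-- The faces of a uniform family form a uniform family. -/
theorem face {ι : Type*} {σ : ι → Simplex (n + 1) X} (h : IsUniformFamily σ) (j : Fin (n + 2)) :
    IsUniformFamily fun i => face j (σ i) where
  locallyFinite r hr := by
    obtain ⟨K, hK⟩ := h.locallyFinite r hr
    refine ⟨K, fun x => le_trans (encard_le_encard ?_) (hK x)⟩
    rintro i ⟨_, hy, ⟨z, rfl⟩⟩
    exact ⟨_, hy, ⟨_, rfl⟩⟩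
  equicontinuous x U hU :=
    ((stdSimplex.continuous_map j.succAbove).tendsto x).eventually (h.equicontinuous _ U hU)

/-- Effectively proper uniformly continuous maps preserve uniform families. -/
theorem map {ι : Type*} {σ : ι → Simplex n X} (h : IsUniformFamily σ) (f : EPUC X Y) :
    IsUniformFamily fun i => f.mapSimplex n (σ i) where
  locallyFinite r hr := by
    obtain ⟨s, hs, H⟩ := f.effectivelyProper (2 * r) (by positivity)
    obtain ⟨K, hK⟩ := h.locallyFinite s hs
    refine ⟨K, fun y => ?_⟩
    by_cases hy : ∃ x, dist (f.toFun x) y < r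
    · obtain ⟨x, hx⟩ := hy
      refine le_trans (encard_le_encard ?_) (hK x)
      rintro i ⟨_, hz, ⟨z, rfl⟩⟩
      refine ⟨σ i z, H _ _ ?_, ⟨z, rfl⟩⟩
      have h1 : dist (f.toFun (σ i z)) y < r := hz
      have h2 := dist_triangle_right (f.toFun (σ i z)) (f.toFun x) y
      linarith
    · push Not at hy
      have : {i | (Metric.ball y r ∩ range (f.mapSimplex n (σ i))).Nonempty} = ∅ := by
        rw [eq_empty_iff_forall_notMem]
        rintro i ⟨_, hz, ⟨z, rfl⟩⟩
        exact absurd hz (not_lt.mpr (hy (σ i z)))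
      rw [this]
      simp
  equicontinuous x U hU := h.equicontinuous x _ (f.uniformContinuous hU)

/-- In a uniform family the number of members (indices) equal to a given simplex is
bounded. -/
theorem exists_encard_fiber_le {ι : Type*} {σ : ι → Simplex n X} (h : IsUniformFamily σ) :
    ∃ K : ℕ, ∀ τ, {i | σ i = τ}.encard ≤ K := by
  obtain ⟨K, hK⟩ := h.locallyFinite 1 one_pos
  refine ⟨K, fun τ => ?_⟩
  let z : stdSimplex ℝ (Fin (n + 1)) := Classical.arbitrary _
  refine le_trans (encard_le_encard ?_) (hK (τ z))
  rintro i rfl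
  exact ⟨_, Metric.mem_ball_self one_pos, ⟨z, rfl⟩⟩

/-- The set of members of a uniform family, indexed by itself, is a uniform family. -/
theorem range {ι : Type*} {σ : ι → Simplex n X} (h : IsUniformFamily σ) :
    IsUniformFamily (Subtype.val : range σ → Simplex n X) := by
  choose g hg using fun τ : Set.range σ => τ.2
  have hinj : Function.Injective g := fun a b hab => Subtype.ext (by rw [← hg a, ← hg b, hab])
  have : (Subtype.val : Set.range σ → Simplex n X) = σ ∘ g := funext fun τ => (hg τ).symm
  rw [this]
  exact h.comp_injective hinj

theorem mono {S T : Set (Simplex n X)} (h : IsUniformFamily (Subtype.val : T → Simplex n X))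
    (hST : S ⊆ T) : IsUniformFamily (Subtype.val : S → Simplex n X) :=
  h.comp_injective (Set.inclusion_injective hST)

theorem union {S T : Set (Simplex n X)} (hS : IsUniformFamily (Subtype.val : S → Simplex n X))
    (hT : IsUniformFamily (Subtype.val : T → Simplex n X)) :
    IsUniformFamily (Subtype.val : ↥(S ∪ T) → Simplex n X) where
  locallyFinite r hr := by
    obtain ⟨K, hK⟩ := hS.locallyFinite r hr
    obtain ⟨L, hL⟩ := hT.locallyFinite r hr
    refine ⟨K + L, fun x => ?_⟩
    rw [← Subtype.val_injective.encard_image]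
    have hK' := hK x
    have hL' := hL x
    rw [← Subtype.val_injective.encard_image] at hK' hL'
    push_cast
    refine le_trans (le_trans (encard_le_encard ?_) (encard_union_le _ _)) (add_le_add hK' hL')
    rintro _ ⟨⟨τ, hτ⟩, hi, rfl⟩
    rcases hτ with hτ | hτ
    · exact Or.inl ⟨⟨τ, hτ⟩, hi, rfl⟩
    · exact Or.inr ⟨⟨τ, hτ⟩, hi, rfl⟩
  equicontinuous x U hU := by
    filter_upwards [hS.equicontinuous x U hU, hT.equicontinuous x U hU] with y h1 h2
    rintro ⟨τ, hτ | hτ⟩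
    · exact h1 ⟨τ, hτ⟩
    · exact h2 ⟨τ, hτ⟩

end IsUniformFamily

/-- An operation on singular simplices that takes uniform families to uniform families. -/
def PreservesUniform {m n : ℕ} {X Y : Type u} [MetricSpace X] [MetricSpace Y]
    (p : Simplex m X → Simplex n Y) : Prop :=
  ∀ ⦃ι : Type u⦄ ⦃σ : ι → Simplex m X⦄, IsUniformFamily σ → IsUniformFamily fun i => p (σ i)

theorem preservesUniform_face {n : ℕ} {X : Type u} [MetricSpace X] (j : Fin (n + 2)) :
    PreservesUniform (face (X := X) j) := fun _ _ h => h.face j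

theorem preservesUniform_map {X Y : Type u} [MetricSpace X] [MetricSpace Y] (f : EPUC X Y)
    (n : ℕ) : PreservesUniform (f.mapSimplex n) := fun _ _ h => h.map f

theorem alternating_sum_eq_zero {G : Type*} [AddCommGroup G] (n : ℕ)
    (h : Fin (n + 2) → Fin (n + 3) → G)
    (H : ∀ i j : Fin (n + 2), i ≤ j → h i j.succ = h j i.castSucc) :
    ∑ i : Fin (n + 2), ∑ j : Fin (n + 3), ((-1 : ℤ) ^ (i : ℕ) * (-1 : ℤ) ^ (j : ℕ)) • h i j = 0 := by
  classical
  rw [← Finset.sum_product', Finset.univ_product_univ]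
  refine Finset.sum_involution
    (fun ij _ => if hij : (ij.2 : ℕ) ≤ (ij.1 : ℕ) then
        ((Fin.castLT ij.2 (lt_of_le_of_lt hij ij.1.is_lt), ij.1.succ) :
          Fin (n + 2) × Fin (n + 3))
      else (ij.2.pred (by rintro h0; simp [h0] at hij), ij.1.castSucc)) ?_ ?_ ?_ ?_
  · rintro ⟨i, j⟩ -
    by_cases hij : (j : ℕ) ≤ (i : ℕ)
    · simp only [hij, dite_true]
      have := H (Fin.castLT j (lt_of_le_of_lt hij i.is_lt)) i hij
      rw [Fin.castSucc_castLT] at this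
      rw [this, ← add_smul]
      simp only [Fin.val_succ, Fin.val_castLT]
      ring_nf
      simp
    · simp only [hij, dite_false]
      have hj : j ≠ 0 := by rintro h0; simp [h0] at hij
      have := H i (j.pred hj) (by rw [Fin.le_def, Fin.val_pred]; lia)
      rw [Fin.succ_pred] at this
      rw [this, ← add_smul]
      obtain ⟨k, rfl⟩ := Fin.exists_succ_eq.mpr hj
      simp only [Fin.val_succ, Fin.pred_succ, Fin.val_castSucc]
      ring_nf
      simp
  · rintro ⟨i, j⟩ - - heq
    by_cases hij : (j : ℕ) ≤ (i : ℕ)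
    · simp only [hij, dite_true, Prod.mk.injEq] at heq
      have := congrArg Fin.val heq.2
      simp only [Fin.val_succ] at this
      lia
    · simp only [hij, dite_false, Prod.mk.injEq] at heq
      have := congrArg Fin.val heq.2
      simp only [Fin.val_castSucc] at this
      lia
  · intros
    exact Finset.mem_univ _
  · rintro ⟨i, j⟩ -
    by_cases hij : (j : ℕ) ≤ (i : ℕ)
    · have h2 : ¬ ((i.succ : Fin (n + 3)) : ℕ) ≤
          ((Fin.castLT j (lt_of_le_of_lt hij i.is_lt) : Fin (n + 2)) : ℕ) := by
        simp only [Fin.val_succ, Fin.val_castLT]; lia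
      simp only [hij, dite_true, h2, dite_false, Fin.pred_succ, Fin.castSucc_castLT]
    · have hj : j ≠ 0 := by rintro h0; simp [h0] at hij
      have h2 : ((i.castSucc : Fin (n + 3)) : ℕ) ≤ ((j.pred hj : Fin (n + 2)) : ℕ) := by
        simp only [Fin.val_castSucc, Fin.val_pred]; lia
      simp only [hij, dite_false, h2, dite_true, Fin.castLT_castSucc, Fin.succ_pred]

/-! ### Uniform bounded cohomology -/

section Cohomology

variable (A : Type v) [SeminormedAddCommGroup A]

/-- Uniform bounded `n`-cochains: singular cochains that are bounded on every uniform family. -/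
def UBCochain (X : Type u) [MetricSpace X] (n : ℕ) : AddSubgroup (Simplex n X → A) where
  carrier := {w | ∀ (ι : Type u) (σ : ι → Simplex n X), IsUniformFamily σ →
    ∃ C : ℝ, ∀ i, ‖w (σ i)‖ ≤ C}
  zero_mem' _ _ _ := ⟨0, fun _ => by simp⟩
  add_mem' hw hw' ι σ hσ := by
    obtain ⟨C, hC⟩ := hw ι σ hσ
    obtain ⟨C', hC'⟩ := hw' ι σ hσ
    exact ⟨C + C', fun i => (norm_add_le _ _).trans (add_le_add (hC i) (hC' i))⟩
  neg_mem' hw ι σ hσ := by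
    obtain ⟨C, hC⟩ := hw ι σ hσ
    exact ⟨C, fun i => by simpa using hC i⟩

variable {A} in
/-- The index types of the uniform families in the definition of a uniform bounded cochain may be
taken in any universe. -/
theorem UBCochain.bounded {X : Type u} [MetricSpace X] {n : ℕ} (w : UBCochain A X n)
    {ι : Type*} {σ : ι → Simplex n X} (hσ : IsUniformFamily σ) :
    ∃ C : ℝ, ∀ i, ‖w.1 (σ i)‖ ≤ C := by
  obtain ⟨C, hC⟩ := w.2 _ _ hσ.range
  exact ⟨C, fun i => hC ⟨σ i, i, rfl⟩⟩

variable {X Y : Type u} [MetricSpace X] [MetricSpace Y]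

/-- Pulling back uniform bounded cochains, `w ↦ w ∘ p`. -/
def pull {m n : ℕ} (p : Simplex m X → Simplex n Y) (hp : PreservesUniform p) :
    UBCochain A Y n →+ UBCochain A X m where
  toFun w := ⟨fun σ => w.1 (p σ), fun _ _ hσ => w.2 _ _ (hp hσ)⟩
  map_zero' := rfl
  map_add' _ _ := rfl

variable (X) in
/-- The coboundary, `(δ w)(σ) = w(∂ σ) = ∑ⱼ (-1)ʲ w(∂ⱼ σ)`. -/
def coboundary (n : ℕ) : UBCochain A X n →+ UBCochain A X (n + 1) :=
  ∑ j : Fin (n + 2), (-1 : ℤ) ^ (j : ℕ) • pull A (face j) (preservesUniform_face j)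

theorem coboundary_apply {n : ℕ} (w : UBCochain A X n) (σ : Simplex (n + 1) X) :
    (coboundary A X n w).1 σ = ∑ j : Fin (n + 2), (-1 : ℤ) ^ (j : ℕ) • w.1 (face j σ) := by
  simp [coboundary, pull]

theorem coboundary_coboundary (n : ℕ) :
    (coboundary A X (n + 1)).comp (coboundary A X n) = 0 := by
  ext w σ
  simp only [AddMonoidHom.comp_apply, coboundary_apply, Finset.smul_sum, smul_smul]
  rw [Finset.sum_comm]
  refine Eq.trans ?_ (alternating_sum_eq_zero n (fun i j => w.1 (face i (face j σ)))
    fun i j hij => by rw [face_face σ hij])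
  simp only [mul_comm]

variable (X) in
/-- The cochain complex of uniform bounded cochains. -/
def ubCochainComplex : CochainComplex AddCommGrpCat.{max u v} ℕ :=
  CochainComplex.of (fun n => AddCommGrpCat.of (UBCochain A X n))
    (fun n => AddCommGrpCat.ofHom (coboundary A X n))
    (fun n => by
      rw [← AddCommGrpCat.ofHom_comp, coboundary_coboundary]
      rfl)

theorem ubCochainComplex_d (n : ℕ) :
    (ubCochainComplex A X).d n (n + 1) = AddCommGrpCat.ofHom (coboundary A X n) :=
  CochainComplex.of_d (fun n => AddCommGrpCat.of (UBCochain A X n))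
    (fun n => AddCommGrpCat.ofHom (coboundary A X n)) n

/-- The cochain map induced by an effectively proper uniformly continuous map. -/
def ubCochainMap (f : EPUC X Y) : ubCochainComplex A Y ⟶ ubCochainComplex A X :=
  CochainComplex.ofHom
    (fun n => AddCommGrpCat.ofHom (pull A (f.mapSimplex n) (preservesUniform_map f n)))
    (fun n => by
      rw [ubCochainComplex_d, ubCochainComplex_d]
      refine Eq.trans (AddCommGrpCat.ofHom_comp _ _).symm
        (Eq.trans ?_ (AddCommGrpCat.ofHom_comp _ _))
      congr 1
      ext w σ
      simp only [AddMonoidHom.comp_apply, coboundary_apply]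
      simp [pull, coboundary_apply, EPUC.face_mapSimplex])

variable (X) in
/-- Uniform bounded cohomology. -/
def ubCohomology (n : ℕ) : AddCommGrpCat.{max u v} :=
  (ubCochainComplex A X).homology n

/-- The map induced in uniform bounded cohomology. -/
def ubCohomologyMap (f : EPUC X Y) (n : ℕ) : ubCohomology A Y n →+ ubCohomology A X n :=
  (HomologicalComplex.homologyMap (ubCochainMap A f) n).hom

/-- The maps `H(X) → H(U) ⊕ H(V)`, `x ↦ (i_U^* x, i_V^* x)`, of the Mayer-Vietoris sequence. -/
def mvRestrict (U V : Set X) (n : ℕ) :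
    ubCohomology A X n →+ ubCohomology A U n × ubCohomology A V n :=
  (ubCohomologyMap A (EPUC.subspace U) n).prod (ubCohomologyMap A (EPUC.subspace V) n)

/-- The maps `H(U) ⊕ H(V) → H(U ∩ V)`, `(a, b) ↦ j_U^* a - j_V^* b`, of the Mayer-Vietoris
sequence. -/
def mvRestrictDiff (U V : Set X) (n : ℕ) :
    ubCohomology A U n × ubCohomology A V n →+ ubCohomology A ↥(U ∩ V) n :=
  (ubCohomologyMap A (EPUC.inclusion (inter_subset_left : U ∩ V ⊆ U)) n).comp
      (AddMonoidHom.fst _ _) -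
    (ubCohomologyMap A (EPUC.inclusion (inter_subset_right : U ∩ V ⊆ V)) n).comp
      (AddMonoidHom.snd _ _)

/-- The relative cochain complex of the pair `(X, S)`: the kernel of the restriction from the
cochains on `X` to the cochains on the subspace `S`. -/
def relCochainComplex (S : Set X) : CochainComplex AddCommGrpCat.{max u v} ℕ :=
  kernel (ubCochainMap A (EPUC.subspace S))

/-- The relative cochain map induced by a map of pairs `(X, S) → (Y, T)`. -/
def relCochainMap (f : EPUC X Y) {S : Set X} {T : Set Y} (h : MapsTo f.toFun S T) :
    relCochainComplex A T ⟶ relCochainComplex A S :=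
  kernel.map _ _ (ubCochainMap A f) (ubCochainMap A (f.restrict h)) (by
    ext n : 1
    rfl)

/-- Uniform bounded cohomology of the pair `(X, S)`. -/
def relCohomology (S : Set X) (n : ℕ) : AddCommGrpCat.{max u v} :=
  (relCochainComplex A S).homology n

/-- The map induced in relative uniform bounded cohomology by a map of pairs
`(X, S) → (Y, T)`. -/
def relCohomologyMap (f : EPUC X Y) {S : Set X} {T : Set Y} (h : MapsTo f.toFun S T) (n : ℕ) :
    relCohomology A T n →+ relCohomology A S n :=
  (HomologicalComplex.homologyMap (relCochainMap A f h) n).hom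

end Cohomology

/-! ### Uniform bounded homology -/

section Homology

variable (A : Type v) [SeminormedAddCommGroup A]

/-- Uniform bounded `n`-chains: possibly infinite formal sums `∑ c(σ) σ`, given by their
coefficient functions, whose coefficients are bounded and whose support is a uniform family. -/
def UBChain (X : Type u) [MetricSpace X] (n : ℕ) : AddSubgroup (Simplex n X → A) where
  carrier := {c | IsUniformFamily (Subtype.val : Function.support c → Simplex n X) ∧
    ∃ C : ℝ, ∀ σ, ‖c σ‖ ≤ C}
  zero_mem' := by
    refine ⟨⟨fun r _ => ⟨0, fun x => ?_⟩, fun x U _ => ?_⟩, 0, fun _ => by simp⟩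
    · rw [Nat.cast_zero, nonpos_iff_eq_zero, encard_eq_zero, eq_empty_iff_forall_notMem]
      exact fun i => absurd rfl i.2
    · exact Filter.Eventually.of_forall fun _ i => absurd rfl i.2
  add_mem' hc hc' := by
    obtain ⟨h, C, hC⟩ := hc
    obtain ⟨h', C', hC'⟩ := hc'
    exact ⟨(h.union h').mono (Function.support_add _ _),
      C + C', fun i => (norm_add_le _ _).trans (add_le_add (hC i) (hC' i))⟩
  neg_mem' {c} hc := by
    obtain ⟨h, C, hC⟩ := hc
    refine ⟨h.mono ?_, C, fun i => by simpa using hC i⟩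
    rw [Function.support_neg]

/-- Transport of a formal sum along a map `p` of basis elements, `∑ c(s) s ↦ ∑ c(s) p(s)`: the
coefficient of `t` is the sum of `c(s)` over all `s` with `p(s) = t`. -/
def pushFun {S T : Type*} {A} [SeminormedAddCommGroup A] (p : S → T) (c : S → A) (t : T) : A :=
  ∑ᶠ s ∈ p ⁻¹' {t}, c s

variable {A} in
theorem norm_pushFun_le {S T : Type*} {p : S → T} {c : S → A} {t : T} {K : ℕ} {C : ℝ}
    (hK : (p ⁻¹' {t} ∩ Function.support c).encard ≤ K) (hC : ∀ s, ‖c s‖ ≤ C) (hC0 : 0 ≤ C) :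
    ‖pushFun p c t‖ ≤ K * C := by
  have hfin : (p ⁻¹' {t} ∩ Function.support c).Finite := finite_of_encard_le_coe hK
  rw [pushFun, finsum_mem_eq_sum _ hfin]
  refine (norm_sum_le_of_le _ fun s _ => hC s).trans ?_
  rw [Finset.sum_const, nsmul_eq_mul]
  refine mul_le_mul_of_nonneg_right ?_ hC0
  rw [hfin.encard_eq_coe_toFinset_card] at hK
  exact_mod_cast hK

variable {A} in
theorem pushFun_pushFun {S T R : Type*} (p : S → T) (q : T → R) (c : S → A)
    (hfin : ∀ r, ((q ∘ p) ⁻¹' {r} ∩ Function.support c).Finite) :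
    pushFun q (pushFun p c) = pushFun (q ∘ p) c := by
  classical
  ext r
  have key : ∀ t, q t = r → pushFun p c t = ∑ s ∈ (hfin r).toFinset with p s = t, c s := by
    intro t ht
    refine finsum_mem_eq_sum_of_inter_support_eq _ ?_
    ext s
    simp only [mem_inter_iff, mem_preimage, mem_singleton_iff, Function.mem_support,
      Finset.coe_filter, Finite.mem_toFinset, Function.comp_apply, mem_ofPred_eq]
    constructor
    · rintro ⟨rfl, h⟩
      exact ⟨⟨⟨ht, h⟩, rfl⟩, h⟩
    · rintro ⟨⟨-, h⟩, h'⟩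
      exact ⟨h, h'⟩
  have h1 : pushFun q (pushFun p c) r = ∑ t ∈ (hfin r).toFinset.image p, pushFun p c t := by
    refine finsum_mem_eq_sum_of_subset _ ?_ ?_
    · rintro t ⟨ht, hs⟩
      rw [Function.mem_support, key t ht] at hs
      obtain ⟨s, hs, -⟩ := Finset.exists_ne_zero_of_sum_ne_zero hs
      rw [Finset.mem_filter] at hs
      exact Finset.mem_coe.mpr (Finset.mem_image.mpr ⟨s, hs.1, hs.2⟩)
    · intro t ht
      obtain ⟨s, hs, rfl⟩ := Finset.mem_image.mp (Finset.mem_coe.mp ht)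
      exact ((hfin r).mem_toFinset.mp hs).1
  rw [h1, pushFun, finsum_mem_eq_sum _ (hfin r)]
  rw [← Finset.sum_fiberwise_of_maps_to (s := (hfin r).toFinset)
    (t := (hfin r).toFinset.image p) (g := p) fun s hs => Finset.mem_image_of_mem p hs]
  refine Finset.sum_congr rfl fun t ht => key t ?_
  obtain ⟨s, hs, rfl⟩ := Finset.mem_image.mp ht
  exact ((hfin r).mem_toFinset.mp hs).1

variable {X Y Z : Type u} [MetricSpace X] [MetricSpace Y] [MetricSpace Z]

variable {A} in
theorem exists_encard_preimage_le {m n : ℕ} {p : Simplex m X → Simplex n Y}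
    (hp : PreservesUniform p) (c : UBChain A X m) :
    ∃ K : ℕ, ∀ t, (p ⁻¹' {t} ∩ Function.support c.1).encard ≤ K := by
  obtain ⟨K, hK⟩ := (hp c.2.1).exists_encard_fiber_le
  refine ⟨K, fun t => le_trans ?_ (hK t)⟩
  rw [← Subtype.val_injective.encard_image]
  apply encard_le_encard
  rintro s ⟨hs, hs'⟩
  exact ⟨⟨s, hs'⟩, hs, rfl⟩

variable {A} in
theorem finite_preimage {m n : ℕ} {p : Simplex m X → Simplex n Y}
    (hp : PreservesUniform p) (c : UBChain A X m) (t : Simplex n Y) :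
    (p ⁻¹' {t} ∩ Function.support c.1).Finite := by
  obtain ⟨K, hK⟩ := exists_encard_preimage_le hp c
  exact finite_of_encard_le_coe (hK t)

/-- Pushing forward uniform bounded chains, `∑ c(σ) σ ↦ ∑ c(σ) p(σ)`. -/
def push {m n : ℕ} (p : Simplex m X → Simplex n Y) (hp : PreservesUniform p) :
    UBChain A X m →+ UBChain A Y n where
  toFun c := ⟨pushFun p c.1, by
    constructor
    · refine (hp c.2.1).range.mono ?_
      intro t ht
      obtain ⟨s, hs, hs'⟩ := exists_ne_zero_of_finsum_mem_ne_zero ht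
      exact ⟨⟨s, hs'⟩, hs⟩
    · obtain ⟨K, hK⟩ := exists_encard_preimage_le hp c
      obtain ⟨C, hC⟩ := c.2.2
      exact ⟨K * max C 0, fun t => norm_pushFun_le (hK t)
        (fun s => (hC s).trans (le_max_left _ _)) (le_max_right _ _)⟩⟩
  map_zero' := by
    ext t
    simp [pushFun]
  map_add' c c' := by
    ext t
    exact finsum_mem_add_distrib' (finite_preimage hp c t) (finite_preimage hp c' t)

theorem push_comp {l m n : ℕ} {p : Simplex l X → Simplex m Y} {q : Simplex m Y → Simplex n Z}
    (hp : PreservesUniform p) (hq : PreservesUniform q) (hqp : PreservesUniform (q ∘ p)) :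
    (push A q hq).comp (push A p hp) = push A (q ∘ p) hqp := by
  ext c : 2
  exact pushFun_pushFun p q c.1 fun r => finite_preimage hqp c r

theorem push_push_eq {l m m' n : ℕ} {Y' : Type u} [MetricSpace Y']
    {p : Simplex l X → Simplex m Y} {q : Simplex m Y → Simplex n Z}
    {p' : Simplex l X → Simplex m' Y'} {q' : Simplex m' Y' → Simplex n Z}
    (hp : PreservesUniform p) (hq : PreservesUniform q)
    (hp' : PreservesUniform p') (hq' : PreservesUniform q') (h : ∀ σ, q (p σ) = q' (p' σ)) :
    (push A q hq).comp (push A p hp) = (push A q' hq').comp (push A p' hp') := by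
  have e : q ∘ p = q' ∘ p' := funext h
  have h1 : PreservesUniform (q ∘ p) := fun _ _ hσ => hq (hp hσ)
  have h2 : PreservesUniform (q' ∘ p') := fun _ _ hσ => hq' (hp' hσ)
  rw [push_comp A hp hq h1, push_comp A hp' hq' h2]
  congr 1

variable (X) in
/-- The boundary, `∂ (∑ c(σ) σ) = ∑ c(σ) ∂σ = ∑ⱼ (-1)ʲ ∑ c(σ) ∂ⱼσ`. -/
def boundary (n : ℕ) : UBChain A X (n + 1) →+ UBChain A X n :=
  ∑ j : Fin (n + 2), (-1 : ℤ) ^ (j : ℕ) • push A (face j) (preservesUniform_face j)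

theorem boundary_eq {n : ℕ} (c : UBChain A X (n + 1)) :
    boundary A X n c = ∑ j : Fin (n + 2), (-1 : ℤ) ^ (j : ℕ) •
      push A (face j) (preservesUniform_face j) c := by
  simp [boundary]

theorem boundary_boundary (n : ℕ) :
    (boundary A X n).comp (boundary A X (n + 1)) = 0 := by
  ext c : 1
  simp only [AddMonoidHom.comp_apply, boundary_eq, map_sum, map_zsmul, Finset.smul_sum, smul_smul]
  rw [Finset.sum_comm]
  refine Eq.trans ?_ (alternating_sum_eq_zero n (fun i j =>
    push A (face i) (preservesUniform_face i) (push A (face j) (preservesUniform_face j) c))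
    fun i j hij => ?_)
  · refine Finset.sum_congr rfl fun i _ => Finset.sum_congr rfl fun j _ => ?_
    rw [mul_comm]
  · exact DFunLike.congr_fun (push_push_eq A (preservesUniform_face j.succ)
      (preservesUniform_face i) (preservesUniform_face i.castSucc) (preservesUniform_face j)
      fun σ => face_face σ hij) c

variable (X) in
/-- The chain complex of uniform bounded chains. -/
def ubChainComplex : ChainComplex AddCommGrpCat.{max u v} ℕ :=
  ChainComplex.of (fun n => AddCommGrpCat.of (UBChain A X n))
    (fun n => AddCommGrpCat.ofHom (boundary A X n))
    (fun n => by
      rw [← AddCommGrpCat.ofHom_comp, boundary_boundary]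
      rfl)

theorem ubChainComplex_d (n : ℕ) :
    (ubChainComplex A X).d (n + 1) n = AddCommGrpCat.ofHom (boundary A X n) :=
  ChainComplex.of_d (fun n => AddCommGrpCat.of (UBChain A X n))
    (fun n => AddCommGrpCat.ofHom (boundary A X n)) n

/-- The chain map induced by an effectively proper uniformly continuous map. -/
def ubChainMap (f : EPUC X Y) : ubChainComplex A X ⟶ ubChainComplex A Y :=
  ChainComplex.ofHom
    (fun n => AddCommGrpCat.ofHom (push A (f.mapSimplex n) (preservesUniform_map f n)))
    (fun n => by
      rw [ubChainComplex_d, ubChainComplex_d]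
      refine Eq.trans (AddCommGrpCat.ofHom_comp _ _).symm
        (Eq.trans ?_ (AddCommGrpCat.ofHom_comp _ _))
      congr 1
      ext c : 1
      simp only [AddMonoidHom.comp_apply, boundary_eq, map_sum, map_zsmul]
      refine Finset.sum_congr rfl fun j _ => ?_
      congr 1
      exact DFunLike.congr_fun (push_push_eq A (preservesUniform_map f (n + 1))
        (preservesUniform_face j) (preservesUniform_face j) (preservesUniform_map f n)
        fun σ => f.face_mapSimplex j σ) c)

variable (X) in
/-- Uniform bounded homology. -/
def ubHomology (n : ℕ) : AddCommGrpCat.{max u v} :=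
  (ubChainComplex A X).homology n

/-- The map induced in uniform bounded homology. -/
def ubHomologyMap (f : EPUC X Y) (n : ℕ) : ubHomology A X n →+ ubHomology A Y n :=
  (HomologicalComplex.homologyMap (ubChainMap A f) n).hom

/-- The maps `H(U ∩ V) → H(U) ⊕ H(V)`, `x ↦ ((j_U)_* x, (j_V)_* x)`, of the Mayer-Vietoris
sequence. -/
def mvExtend (U V : Set X) (n : ℕ) :
    ubHomology A ↥(U ∩ V) n →+ ubHomology A U n × ubHomology A V n :=
  (ubHomologyMap A (EPUC.inclusion (inter_subset_left : U ∩ V ⊆ U)) n).prod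
    (ubHomologyMap A (EPUC.inclusion (inter_subset_right : U ∩ V ⊆ V)) n)

/-- The maps `H(U) ⊕ H(V) → H(X)`, `(a, b) ↦ (i_U)_* a - (i_V)_* b`, of the Mayer-Vietoris
sequence. -/
def mvExtendDiff (U V : Set X) (n : ℕ) :
    ubHomology A U n × ubHomology A V n →+ ubHomology A X n :=
  (ubHomologyMap A (EPUC.subspace U) n).comp (AddMonoidHom.fst _ _) -
    (ubHomologyMap A (EPUC.subspace V) n).comp (AddMonoidHom.snd _ _)

/-- The relative chain complex of the pair `(X, S)`: the quotient of the chains on `X` by the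
chains on the subspace `S`. -/
def relChainComplex (S : Set X) : ChainComplex AddCommGrpCat.{max u v} ℕ :=
  cokernel (ubChainMap A (EPUC.subspace S))

/-- The relative chain map induced by a map of pairs `(X, S) → (Y, T)`. -/
def relChainMap (f : EPUC X Y) {S : Set X} {T : Set Y} (h : MapsTo f.toFun S T) :
    relChainComplex A S ⟶ relChainComplex A T :=
  cokernel.map _ _ (ubChainMap A (f.restrict h)) (ubChainMap A f) (by
    ext n c : 3
    exact DFunLike.congr_fun (push_push_eq A (preservesUniform_map (EPUC.subspace S) n)
      (preservesUniform_map f n) (preservesUniform_map (f.restrict h) n)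
      (preservesUniform_map (EPUC.subspace T) n) fun σ => rfl) c)

/-- Uniform bounded homology of the pair `(X, S)`. -/
def relHomology (S : Set X) (n : ℕ) : AddCommGrpCat.{max u v} :=
  (relChainComplex A S).homology n

/-- The map induced in relative uniform bounded homology by a map of pairs
`(X, S) → (Y, T)`. -/
def relHomologyMap (f : EPUC X Y) {S : Set X} {T : Set Y} (h : MapsTo f.toFun S T) (n : ℕ) :
    relHomology A S n →+ relHomology A T n :=
  (HomologicalComplex.homologyMap (relChainMap A f h) n).hom

end Homology

/-- A collection `𝒰` of subsets of `X` has Lebesgue number `ε` if every subset of `X` of diameter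
less than `ε` is contained in a member of `𝒰`. -/
def HasLebesgueNumber {X : Type u} [MetricSpace X] (𝒰 : Set (Set X)) (ε : ℝ) : Prop :=
  ∀ S : Set X, Metric.ediam S < ENNReal.ofReal ε → ∃ W ∈ 𝒰, S ⊆ W

/-- For `Y ⊆ X` and `Z ⊆ X`, the subset `Y - Z` of the subspace `X - Z = Zᶜ`. -/
def removed {X : Type u} (Y Z : Set X) : Set ↥(Zᶜ) := {x | (x : X) ∈ Y}

/-- The inclusion `X - Z → X` is a map of pairs `(X - Z, Y - Z) → (X, Y)`. -/
theorem mapsTo_removed {X : Type u} [MetricSpace X] (Y Z : Set X) :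
    MapsTo (EPUC.subspace Zᶜ).toFun (removed Y Z) Y := fun _ h => h

end UniformBounded

end

open UniformBounded

/-! Everything rests on a theorem of small simplices. Call a simplex small if its image lies in a
member of the cover `{U, V}`. The cochains on `X` that restrict to zero on `U` and on `V` are those
vanishing on small simplices, and the differences of chains from `U` and `V` are the chains with
small support. The former complex is acyclic (`exists_null_coboundary_eq`), and so is the quotient
of all chains by the latter (`exists_sub_boundary_mem_smallChains`). Apart from these defects, the
sequences C(X) → C(U) ⊕ C(V) → C(U ∩ V) of cochains and C(U ∩ V) → C(U) ⊕ C(V) → C(X) of chains are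
short exact. Extension of cochains by zero stays within uniform bounded cochains, because the
members of a uniform family that lie in a subspace form a uniform family there.

Barycentric subdivision sd and its homotopy T to the identity are finite integral combinations of
affine simplices in the standard simplex, so they act on uniform bounded chains and cochains. An
equicontinuous family on the compact standard simplex is uniformly equicontinuous; hence one number
of subdivisions makes all its members small. A chain is supported on a single uniform family, so the
classical argument applies with one exponent. A cochain sees all families at once and no exponent
suffices. Instead, a null cocycle `w` is the coboundary of the infinite sum of the cochains
(sdⁱ)*T*w, which on each uniform family reduces to one finite partial sum.

`IsMayerVietorisSquare` isolates the common algebra: exactness in the middle, with acyclic kernel on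
the left and acyclic cokernel on the right, already gives the long exact sequence. For excision the
cover is `{Zᶜ, Y}`. The map of relative cochains is surjective with the null cochains as kernel, and
the map of relative chains is injective with cokernel the chains modulo small chains. -/

noncomputable section

namespace UniformBounded

open CategoryTheory CategoryTheory.Limits Set

/-! ### Homology classes of complexes of abelian groups, in terms of elements -/

section HomologyClasses

variable {ι : Type*} {c : ComplexShape ι} (K : HomologicalComplex AddCommGrpCat.{u} c)

/-- The group of cycles of a complex of abelian groups. -/
def cycleSubgroup (i : ι) : AddSubgroup (K.X i) :=
  (K.d i (c.next i)).hom.ker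

theorem mem_cycleSubgroup {i j : ι} (h : c.next i = j) {z : K.X i} :
    z ∈ cycleSubgroup K i ↔ K.d i j z = 0 := by
  subst h
  rfl

/-- A cycle as an element of the categorical object of cycles. -/
def cyclesElement (i : ι) : cycleSubgroup K i →+ K.cycles i :=
  (K.sc i).abCyclesIso.inv.hom

theorem iCycles_cyclesElement (i : ι) (z : cycleSubgroup K i) :
    K.iCycles i (cyclesElement K i z) = z.1 :=
  (K.sc i).abCyclesIso_inv_apply_iCycles z

theorem cyclesElement_surjective (i : ι) : Function.Surjective (cyclesElement K i) := fun z =>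
  ⟨(K.sc i).abCyclesIso.hom z, ConcreteCategory.congr_hom (K.sc i).abCyclesIso.hom_inv_id z⟩

theorem iCycles_injective (i : ι) : Function.Injective (K.iCycles i) :=
  (AddCommGrpCat.mono_iff_injective _).1 inferInstance

/-- The homology class of a cycle. -/
def homologyClass (i : ι) : cycleSubgroup K i →+ K.homology i :=
  (K.homologyπ i).hom.comp (cyclesElement K i)

theorem homologyClass_surjective (i : ι) : Function.Surjective (homologyClass K i) := by
  intro h
  obtain ⟨z, rfl⟩ := (AddCommGrpCat.epi_iff_surjective (K.homologyπ i)).1 inferInstance h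
  obtain ⟨z, rfl⟩ := cyclesElement_surjective K i z
  exact ⟨z, rfl⟩

/-- This covers the extreme degrees too: if nothing precedes `i`, then `c.prev i = i` with zero
differential, and the condition reads `z = 0`. -/
theorem homologyClass_eq_zero_iff {h i : ι} (hi : c.prev i = h) (z : cycleSubgroup K i) :
    homologyClass K i z = 0 ↔ ∃ b : K.X h, K.d h i b = z.1 := by
  have ex : (ShortComplex.mk (K.toCycles h i) (K.homologyπ i) (by simp)).Exact :=
    ShortComplex.exact_of_g_is_cokernel _ (K.homologyIsCokernel h i hi)
  rw [ShortComplex.ab_exact_iff_function_exact] at ex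
  refine (ex _).trans (exists_congr fun b => ?_)
  change K.toCycles h i b = cyclesElement K i z ↔ _
  rw [← (iCycles_injective K i).eq_iff, iCycles_cyclesElement, ← ConcreteCategory.comp_apply,
    K.toCycles_i]

variable {K} {L : HomologicalComplex AddCommGrpCat.{u} c} (φ : K ⟶ L)

theorem d_hom_apply (i j : ι) (z : K.X i) : L.d i j (φ.f i z) = φ.f j (K.d i j z) :=
  ConcreteCategory.congr_hom (φ.comm i j) z

theorem d_d_apply (h i j : ι) (z : K.X h) : K.d i j (K.d h i z) = 0 :=
  ConcreteCategory.congr_hom (K.d_comp_d h i j) z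

/-- The map induced on cycles by a map of complexes. -/
def mapCycle {i : ι} (z : cycleSubgroup K i) : cycleSubgroup L i :=
  ⟨φ.f i z.1, by
    rw [mem_cycleSubgroup L rfl, d_hom_apply, (mem_cycleSubgroup K rfl).1 z.2, map_zero]⟩

theorem homologyMap_homologyClass {i : ι} (z : cycleSubgroup K i) :
    HomologicalComplex.homologyMap φ i (homologyClass K i z) =
      homologyClass L i (mapCycle φ z) := by
  change HomologicalComplex.homologyMap φ i (K.homologyπ i (cyclesElement K i z)) =
    L.homologyπ i (cyclesElement L i (mapCycle φ z))
  rw [← ConcreteCategory.comp_apply, HomologicalComplex.homologyπ_naturality,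
    ConcreteCategory.comp_apply]
  congr 1
  apply iCycles_injective L i
  rw [iCycles_cyclesElement, ← ConcreteCategory.comp_apply, HomologicalComplex.cyclesMap_i,
    ConcreteCategory.comp_apply, iCycles_cyclesElement]
  rfl

theorem homologyClass_eq_iff {h i : ι} (hi : c.prev i = h) (z w : cycleSubgroup K i) :
    homologyClass K i z = homologyClass K i w ↔ ∃ b : K.X h, K.d h i b = z.1 - w.1 := by
  rw [← sub_eq_zero, ← map_sub, homologyClass_eq_zero_iff K hi]
  rfl

/-- A degreewise surjective map of complexes with acyclic kernel induces bijections in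
homology. -/
theorem homologyMap_bijective_of_surjective (hsurj : ∀ i, Function.Surjective (φ.f i)) {i : ι}
    (hker : ∀ i, ∀ z : K.X i, φ.f i z = 0 → K.d i (c.next i) z = 0 →
      ∃ b : K.X (c.prev i), φ.f _ b = 0 ∧ K.d (c.prev i) i b = z) :
    Function.Bijective (HomologicalComplex.homologyMap φ i) := by
  constructor
  · rw [injective_iff_map_eq_zero]
    intro a ha
    obtain ⟨z, rfl⟩ := homologyClass_surjective K i a
    rw [homologyMap_homologyClass, homologyClass_eq_zero_iff L rfl] at ha
    obtain ⟨b, hb⟩ := ha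
    obtain ⟨b, rfl⟩ := hsurj _ b
    rw [d_hom_apply] at hb
    obtain ⟨b', -, hb'⟩ := hker i (z.1 - K.d _ _ b) (by rw [map_sub, hb]; exact sub_self _)
      (by rw [map_sub, d_d_apply, (mem_cycleSubgroup K rfl).1 z.2, sub_zero])
    rw [homologyClass_eq_zero_iff K rfl]
    exact ⟨b' + b, by rw [map_add, hb', sub_add_cancel]⟩
  · intro a
    obtain ⟨w, rfl⟩ := homologyClass_surjective L i a
    obtain ⟨z, hz⟩ := hsurj i w.1
    have hw := (mem_cycleSubgroup L rfl).1 w.2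
    rw [← hz, d_hom_apply] at hw
    by_cases hr : c.Rel i (c.next i)
    · obtain ⟨b, hb, hb'⟩ := hker _ _ hw (d_d_apply _ _ _ _)
      have hp : c.prev (c.next i) = i := c.prev_eq' hr
      have key : ∃ y : K.X i, φ.f i y = 0 ∧ K.d i (c.next i) y = K.d i (c.next i) z := by
        generalize c.prev (c.next i) = k at hp b hb hb'
        subst hp
        exact ⟨b, hb, hb'⟩
      obtain ⟨y, hy, hy'⟩ := key
      refine ⟨homologyClass K i ⟨z - y, ?_⟩, ?_⟩
      · rw [mem_cycleSubgroup K rfl, map_sub, hy', sub_self]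
      · rw [homologyMap_homologyClass]
        congr 1
        exact Subtype.ext (by change φ.f i (z - y) = _; rw [map_sub, hy, hz, sub_zero])
    · refine ⟨homologyClass K i ⟨z, ?_⟩, ?_⟩
      · rw [mem_cycleSubgroup K rfl, K.shape _ _ hr]
        rfl
      · rw [homologyMap_homologyClass]
        congr 1
        exact Subtype.ext hz

/-- A degreewise injective map of complexes with acyclic cokernel induces bijections in
homology. -/
theorem homologyMap_bijective_of_injective (hinj : ∀ i, Function.Injective (φ.f i)) {i : ι}
    (hcoker : ∀ i, ∀ z : L.X i, L.d i (c.next i) z ∈ range (φ.f (c.next i)) →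
      ∃ b : L.X (c.prev i), z - L.d (c.prev i) i b ∈ range (φ.f i)) :
    Function.Bijective (HomologicalComplex.homologyMap φ i) := by
  constructor
  · rw [injective_iff_map_eq_zero]
    intro a ha
    obtain ⟨z, rfl⟩ := homologyClass_surjective K i a
    rw [homologyMap_homologyClass, homologyClass_eq_zero_iff L rfl] at ha
    obtain ⟨b, hb⟩ := ha
    rw [homologyClass_eq_zero_iff K rfl]
    change _ = φ.f i z.1 at hb
    by_cases hr : c.Rel (c.prev i) i
    · have hn : c.next (c.prev i) = i := c.next_eq' hr
      -- The boundary of `b` is the image of `z`, so `b` is a cycle of the cokernel. Subtracting a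
      -- boundary moves `b` into the image of `φ` without changing `d b`, and injectivity of `φ`
      -- descends the equation to `K`.
      obtain ⟨b', x, hx⟩ := hcoker (c.prev i) b (by
        generalize c.next (c.prev i) = k at hn
        subst hn
        exact ⟨_, hb.symm⟩)
      refine ⟨x, hinj i ?_⟩
      rw [← d_hom_apply, hx, map_sub, d_d_apply, sub_zero, hb]
    · rw [L.shape _ _ hr] at hb
      exact ⟨0, hinj i (by rw [map_zero, map_zero, ← hb]; rfl)⟩
  · intro a
    obtain ⟨w, rfl⟩ := homologyClass_surjective L i a
    obtain ⟨b, x, hx⟩ := hcoker i w.1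
      ⟨0, by rw [map_zero, (mem_cycleSubgroup L rfl).1 w.2]⟩
    refine ⟨homologyClass K i ⟨x, ?_⟩, ?_⟩
    · rw [mem_cycleSubgroup K rfl]
      apply hinj
      rw [← d_hom_apply, hx, map_sub, d_d_apply, sub_zero, map_zero,
        (mem_cycleSubgroup L rfl).1 w.2]
    · rw [homologyMap_homologyClass, eq_comm, homologyClass_eq_iff rfl]
      exact ⟨b, by change _ = _ - φ.f i x; rw [hx, sub_sub_cancel]⟩

end HomologyClasses

/-! ### The long exact sequence of a Mayer-Vietoris square -/

section MayerVietoris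

variable {ι : Type*} {c : ComplexShape ι} {P Q Q' R : HomologicalComplex AddCommGrpCat.{u} c}

/-- A commutative square of complexes whose sequence `P → Q ⊕ Q' → R` is exact in the middle, with
acyclic kernel at `P` and acyclic cokernel at `R`. -/
structure IsMayerVietorisSquare (f : P ⟶ Q) (f' : P ⟶ Q') (g : Q ⟶ R) (g' : Q' ⟶ R) : Prop where
  comm : ∀ i (p : P.X i), g.f i (f.f i p) = g'.f i (f'.f i p)
  exact_middle : ∀ i (q : Q.X i) (q' : Q'.X i), g.f i q = g'.f i q' →
    ∃ p, f.f i p = q ∧ f'.f i p = q'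
  acyclic_ker : ∀ h i j, c.prev i = h → c.next i = j → ∀ p : P.X i, f.f i p = 0 → f'.f i p = 0 →
    P.d i j p = 0 → ∃ p' : P.X h, f.f h p' = 0 ∧ f'.f h p' = 0 ∧ P.d h i p' = p
  acyclic_coker : ∀ h i j, c.prev i = h → c.next i = j → ∀ (r : R.X i) (q : Q.X j) (q' : Q'.X j),
    R.d i j r = g.f j q - g'.f j q' →
      ∃ (r' : R.X h) (q : Q.X i) (q' : Q'.X i), r = R.d h i r' + (g.f i q - g'.f i q')

namespace IsMayerVietorisSquare

variable {f : P ⟶ Q} {f' : P ⟶ Q'} {g : Q ⟶ R} {g' : Q' ⟶ R}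

/-- Compatible cycles of `Q` and `Q'` come from a cycle of `P`. -/
theorem exists_cycle (H : IsMayerVietorisSquare f f' g g') {j k : ι} {q : Q.X j} {q' : Q'.X j}
    (hq : Q.d j k q = 0) (hq' : Q'.d j k q' = 0) (h : g.f j q = g'.f j q') :
    ∃ p : P.X j, P.d j k p = 0 ∧ f.f j p = q ∧ f'.f j p = q' := by
  obtain ⟨p, hp, hp'⟩ := H.exact_middle j _ _ h
  by_cases hr : c.Rel j k
  · obtain ⟨p₁, h1, h2, h3⟩ := H.acyclic_ker j k _ (c.prev_eq' hr) rfl (P.d j k p)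
      (by rw [← d_hom_apply, hp, hq]) (by rw [← d_hom_apply, hp', hq']) (d_d_apply _ _ _ _)
    exact ⟨p - p₁, by rw [map_sub, h3, sub_self], by rw [map_sub, h1, sub_zero, hp],
      by rw [map_sub, h2, sub_zero, hp']⟩
  · exact ⟨p, by rw [P.shape _ _ hr]; rfl, hp, hp'⟩

/-- The snake construction. Acyclicity of the cokernel moves `r` by a boundary into the image of `Q
⊕ Q'`; the boundaries of the two lifts then agree in `R` and glue to a cycle of `P`. -/
theorem exists_connects (H : IsMayerVietorisSquare f f' g g') {i j : ι} (hij : c.Rel i j)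
    (r : cycleSubgroup R i) :
    ∃ p : cycleSubgroup P j, ∃ (r' : R.X (c.prev i)) (q : Q.X i) (q' : Q'.X i),
      r.1 = R.d (c.prev i) i r' + (g.f i q - g'.f i q') ∧
      f.f j p.1 = Q.d i j q ∧ f'.f j p.1 = Q'.d i j q' := by
  have hr := (mem_cycleSubgroup R (c.next_eq' hij)).1 r.2
  obtain ⟨r', q, q', h⟩ := H.acyclic_coker _ i j rfl (c.next_eq' hij) r.1 0 0
    (by rw [map_zero, map_zero, sub_zero, hr])
  have h' : g.f j (Q.d i j q) = g'.f j (Q'.d i j q') := by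
    rw [h, map_add, d_d_apply, zero_add, map_sub, sub_eq_zero, d_hom_apply, d_hom_apply] at hr
    exact hr
  obtain ⟨p, hp, h1, h2⟩ := H.exists_cycle (d_d_apply _ _ _ _) (d_d_apply _ _ _ _) h'
  exact ⟨⟨p, hp⟩, r', q, q', h, h1, h2⟩

/-- Well-definedness of the connecting map: by additivity it suffices that data attached to the zero
cycle produce the zero class. -/
theorem boundary_of_connects (H : IsMayerVietorisSquare f f' g g') {i j : ι} (hij : c.Rel i j)
    (p : cycleSubgroup P j)
    {q : Q.X i} {q' : Q'.X i} {r' : R.X (c.prev i)}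
    (hr : R.d (c.prev i) i r' + (g.f i q - g'.f i q') = 0)
    (h1 : f.f j p.1 = Q.d i j q) (h2 : f'.f j p.1 = Q'.d i j q') :
    homologyClass P j p = 0 := by
  have key : ∃ (t : Q.X i) (t' : Q'.X i), Q.d i j t = 0 ∧ Q'.d i j t' = 0 ∧
      g.f i (q - t) = g'.f i (q' - t') := by
    by_cases hi : c.Rel (c.prev i) i
    · obtain ⟨s, t, t', hs⟩ := H.acyclic_coker _ (c.prev i) i rfl (c.next_eq' hi) r' (-q) (-q')
        (by rw [map_neg, map_neg]; rw [← sub_eq_zero, ← hr]; abel)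
      refine ⟨-Q.d _ i t, -Q'.d _ i t', by rw [map_neg, d_d_apply, neg_zero],
        by rw [map_neg, d_d_apply, neg_zero], ?_⟩
      rw [hs, map_add, d_d_apply, zero_add, map_sub, d_hom_apply, d_hom_apply] at hr
      rw [← sub_eq_zero, ← hr]
      simp only [map_sub, map_neg]
      abel
    · rw [R.shape _ _ hi] at hr
      refine ⟨0, 0, map_zero _, map_zero _, ?_⟩
      rw [sub_zero, sub_zero, ← sub_eq_zero, ← hr]
      exact (zero_add _).symm
  obtain ⟨t, t', ht, ht', h⟩ := key
  obtain ⟨s, hs, hs'⟩ := H.exact_middle i _ _ h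
  obtain ⟨p₁, h3, h4, h5⟩ := H.acyclic_ker i j _ (c.prev_eq' hij) rfl (p.1 - P.d i j s)
    (by rw [map_sub, ← d_hom_apply, hs, map_sub, ht, sub_zero, h1, sub_self])
    (by rw [map_sub, ← d_hom_apply, hs', map_sub, ht', sub_zero, h2, sub_self])
    (by rw [map_sub, d_d_apply, (mem_cycleSubgroup P rfl).1 p.2, sub_zero])
  rw [homologyClass_eq_zero_iff P (c.prev_eq' hij)]
  exact ⟨p₁ + s, by rw [map_add, h5, sub_add_cancel]⟩

/-- The value may be computed from any choice of lifts, not only from the chosen ones; additivity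
and both exactness statements use this freedom. -/
theorem exists_connecting (H : IsMayerVietorisSquare f f' g g') {i j : ι} (hij : c.Rel i j) :
    ∃ d : R.homology i →+ P.homology j, ∀ (r : cycleSubgroup R i) (p : cycleSubgroup P j)
      (r' : R.X (c.prev i)) (q : Q.X i) (q' : Q'.X i),
      r.1 = R.d (c.prev i) i r' + (g.f i q - g'.f i q') → f.f j p.1 = Q.d i j q →
      f'.f j p.1 = Q'.d i j q' → d (homologyClass R i r) = homologyClass P j p := by
  choose p r' q q' h1 h2 h3 using fun r => H.exists_connects hij r
  choose z hz using homologyClass_surjective R i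
  have key : ∀ (r : cycleSubgroup R i) (p₁ : cycleSubgroup P j)
      (r₁ : R.X (c.prev i)) (q₁ : Q.X i) (q₁' : Q'.X i),
      r.1 = R.d (c.prev i) i r₁ + (g.f i q₁ - g'.f i q₁') → f.f j p₁.1 = Q.d i j q₁ →
      f'.f j p₁.1 = Q'.d i j q₁' →
        homologyClass P j (p (z (homologyClass R i r))) = homologyClass P j p₁ := by
    intro r p₁ r₁ q₁ q₁' e1 e2 e3
    have hzr := hz (homologyClass R i r)
    generalize z (homologyClass R i r) = w at hzr
    obtain ⟨b, hb⟩ := (homologyClass_eq_iff rfl w r).1 hzr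
    rw [← sub_eq_zero, ← map_sub]
    refine H.boundary_of_connects hij (p w - p₁) (q := q w - q₁) (q' := q' w - q₁')
      (r' := r' w - r₁ - b) ?_ ?_ ?_
    · simp only [map_sub, hb]
      rw [h1 w, e1]
      abel
    · change f.f j ((p w).1 - p₁.1) = _
      rw [map_sub, map_sub, h2, e2]
    · change f'.f j ((p w).1 - p₁.1) = _
      rw [map_sub, map_sub, h3, e3]
  refine ⟨AddMonoidHom.mk' (fun a => homologyClass P j (p (z a))) fun a b => ?_, key⟩
  obtain ⟨r, rfl⟩ := homologyClass_surjective R i a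
  obtain ⟨s, rfl⟩ := homologyClass_surjective R i b
  rw [key r (p r) _ _ _ (h1 r) (h2 r) (h3 r), key s (p s) _ _ _ (h1 s) (h2 s) (h3 s), ← map_add,
    ← map_add]
  refine key (r + s) (p r + p s) (r' r + r' s) (q r + q s) (q' r + q' s) ?_ ?_ ?_
  · change r.1 + s.1 = _
    simp only [map_add]
    rw [h1 r, h1 s]
    abel
  · change f.f j ((p r).1 + (p s).1) = _
    rw [map_add, map_add, h2, h2]
  · change f'.f j ((p r).1 + (p s).1) = _
    rw [map_add, map_add, h3, h3]

/-- Exactness of the Mayer-Vietoris sequence at the middle term. -/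
theorem exact_homology_middle (H : IsMayerVietorisSquare f f' g g') (i : ι) :
    Function.Exact
      ((HomologicalComplex.homologyMap f i).hom.prod (HomologicalComplex.homologyMap f' i).hom)
      ((HomologicalComplex.homologyMap g i).hom.comp
          (AddMonoidHom.fst (Q.homology i) (Q'.homology i)) -
        (HomologicalComplex.homologyMap g' i).hom.comp
          (AddMonoidHom.snd (Q.homology i) (Q'.homology i))) := by
  rintro ⟨a, b⟩
  obtain ⟨q, rfl⟩ := homologyClass_surjective Q i a
  obtain ⟨q', rfl⟩ := homologyClass_surjective Q' i b
  change HomologicalComplex.homologyMap g i (homologyClass Q i q) -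
    HomologicalComplex.homologyMap g' i (homologyClass Q' i q') = 0 ↔ _
  rw [homologyMap_homologyClass, homologyMap_homologyClass, sub_eq_zero, homologyClass_eq_iff rfl]
  constructor
  · rintro ⟨r, hr⟩
    change R.d _ i r = g.f i q.1 - g'.f i q'.1 at hr
    -- Equality of the classes in `R` is improved to equality of cycles by changing `q` and `q'` by
    -- boundaries.
    have key : ∃ (s : Q.X (c.prev i)) (s' : Q'.X (c.prev i)),
        g.f i (q.1 - Q.d _ i s) = g'.f i (q'.1 - Q'.d _ i s') := by
      by_cases hi : c.Rel (c.prev i) i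
      · obtain ⟨r', s, s', h⟩ := H.acyclic_coker _ (c.prev i) i rfl (c.next_eq' hi) r _ _ hr
        refine ⟨s, s', ?_⟩
        rw [h, map_add, d_d_apply, zero_add, map_sub, d_hom_apply, d_hom_apply] at hr
        rw [← sub_eq_zero] at hr ⊢
        rw [← neg_eq_zero, ← hr]
        simp only [map_sub]
        abel
      · refine ⟨0, 0, ?_⟩
        rw [R.shape _ _ hi] at hr
        rw [map_zero, map_zero, sub_zero, sub_zero, ← sub_eq_zero, ← hr]
        rfl
    obtain ⟨s, s', h⟩ := key
    obtain ⟨p, hp0, hp, hp'⟩ := H.exists_cycle (k := c.next i)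
      (by rw [map_sub, d_d_apply, (mem_cycleSubgroup Q rfl).1 q.2, sub_zero])
      (by rw [map_sub, d_d_apply, (mem_cycleSubgroup Q' rfl).1 q'.2, sub_zero]) h
    refine ⟨homologyClass P i ⟨p, hp0⟩, Prod.ext ?_ ?_⟩
    · change HomologicalComplex.homologyMap f i _ = homologyClass Q i q
      rw [homologyMap_homologyClass, eq_comm, homologyClass_eq_iff rfl]
      exact ⟨s, by change _ = _ - f.f i p; rw [hp, sub_sub_cancel]⟩
    · change HomologicalComplex.homologyMap f' i _ = homologyClass Q' i q'
      rw [homologyMap_homologyClass, eq_comm, homologyClass_eq_iff rfl]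
      exact ⟨s', by change _ = _ - f'.f i p; rw [hp', sub_sub_cancel]⟩
  · rintro ⟨a, ha⟩
    obtain ⟨p, rfl⟩ := homologyClass_surjective P i a
    have h1 : HomologicalComplex.homologyMap f i (homologyClass P i p) = homologyClass Q i q :=
      congrArg Prod.fst ha
    have h2 : HomologicalComplex.homologyMap f' i (homologyClass P i p) = homologyClass Q' i q' :=
      congrArg Prod.snd ha
    rw [homologyMap_homologyClass, homologyClass_eq_iff rfl] at h1 h2
    obtain ⟨b, hb⟩ := h1
    obtain ⟨b', hb'⟩ := h2
    change _ = f.f i p.1 - q.1 at hb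
    change _ = f'.f i p.1 - q'.1 at hb'
    refine ⟨g'.f _ b' - g.f _ b, ?_⟩
    change _ = g.f i q.1 - g'.f i q'.1
    rw [map_sub, d_hom_apply, d_hom_apply, hb, hb', map_sub, map_sub, H.comm]
    abel

/-- The connecting homomorphism of the Mayer-Vietoris sequence exists and makes the sequence
exact. -/
theorem exists_exact_connecting (H : IsMayerVietorisSquare f f' g g') {i j : ι} (hij : c.Rel i j) :
    ∃ d : R.homology i →+ P.homology j,
      Function.Exact
        ((HomologicalComplex.homologyMap g i).hom.comp
          (AddMonoidHom.fst (Q.homology i) (Q'.homology i)) -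
          (HomologicalComplex.homologyMap g' i).hom.comp
          (AddMonoidHom.snd (Q.homology i) (Q'.homology i))) d ∧
      Function.Exact d ((HomologicalComplex.homologyMap f j).hom.prod
        (HomologicalComplex.homologyMap f' j).hom) := by
  obtain ⟨d, hd⟩ := H.exists_connecting hij
  have hn := c.next_eq' hij
  have hp := c.prev_eq' hij
  refine ⟨d, fun a => ⟨fun ha => ?_, ?_⟩, fun a => ⟨fun ha => ?_, ?_⟩⟩
  · obtain ⟨r, rfl⟩ := homologyClass_surjective R i a
    obtain ⟨p, r', q, q', h1, h2, h3⟩ := H.exists_connects hij r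
    rw [hd r p r' q q' h1 h2 h3, homologyClass_eq_zero_iff P hp] at ha
    obtain ⟨s, hs⟩ := ha
    -- Subtracting the images of `s` turns `q` and `q'` into cycles, and commutativity of the square
    -- keeps their difference in `R` unchanged.
    refine ⟨(homologyClass Q i ⟨q - f.f i s, ?_⟩, homologyClass Q' i ⟨q' - f'.f i s, ?_⟩), ?_⟩
    · rw [mem_cycleSubgroup Q hn, map_sub, d_hom_apply, hs, h2, sub_self]
    · rw [mem_cycleSubgroup Q' hn, map_sub, d_hom_apply, hs, h3, sub_self]
    · change HomologicalComplex.homologyMap g i (homologyClass Q i _) -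
        HomologicalComplex.homologyMap g' i (homologyClass Q' i _) = _
      rw [homologyMap_homologyClass, homologyMap_homologyClass, ← map_sub, eq_comm,
        homologyClass_eq_iff rfl]
      refine ⟨r', ?_⟩
      change _ = r.1 - (g.f i (q - f.f i s) - g'.f i (q' - f'.f i s))
      rw [map_sub, map_sub, H.comm, h1]
      abel
  · rintro ⟨⟨b, b'⟩, rfl⟩
    obtain ⟨q, rfl⟩ := homologyClass_surjective Q i b
    obtain ⟨q', rfl⟩ := homologyClass_surjective Q' i b'
    change d (HomologicalComplex.homologyMap g i (homologyClass Q i q) -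
        HomologicalComplex.homologyMap g' i (homologyClass Q' i q')) = 0
    rw [homologyMap_homologyClass, homologyMap_homologyClass, ← map_sub,
      hd _ 0 0 q.1 q'.1, map_zero]
    · rw [map_zero, zero_add]
      rfl
    · rw [(mem_cycleSubgroup Q hn).1 q.2]
      exact map_zero _
    · rw [(mem_cycleSubgroup Q' hn).1 q'.2]
      exact map_zero _
  · obtain ⟨p, rfl⟩ := homologyClass_surjective P j a
    have h1 : HomologicalComplex.homologyMap f j (homologyClass P j p) = 0 := congrArg Prod.fst ha
    have h2 : HomologicalComplex.homologyMap f' j (homologyClass P j p) = 0 := congrArg Prod.snd ha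
    rw [homologyMap_homologyClass, homologyClass_eq_zero_iff _ hp] at h1 h2
    obtain ⟨q, hq⟩ := h1
    obtain ⟨q', hq'⟩ := h2
    change _ = f.f j p.1 at hq
    change _ = f'.f j p.1 at hq'
    refine ⟨homologyClass R i ⟨g.f i q - g'.f i q', ?_⟩, hd _ p 0 q q' ?_ hq.symm hq'.symm⟩
    · rw [mem_cycleSubgroup R hn, map_sub, d_hom_apply, d_hom_apply, hq, hq', H.comm, sub_self]
    · rw [map_zero, zero_add]
  · rintro ⟨b, rfl⟩
    obtain ⟨r, rfl⟩ := homologyClass_surjective R i b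
    obtain ⟨p, r', q, q', h1, h2, h3⟩ := H.exists_connects hij r
    rw [hd r p r' q q' h1 h2 h3]
    refine Prod.ext ?_ ?_
    · change HomologicalComplex.homologyMap f j (homologyClass P j p) = 0
      rw [homologyMap_homologyClass, homologyClass_eq_zero_iff _ hp]
      exact ⟨q, h2.symm⟩
    · change HomologicalComplex.homologyMap f' j (homologyClass P j p) = 0
      rw [homologyMap_homologyClass, homologyClass_eq_zero_iff _ hp]
      exact ⟨q', h3.symm⟩

/-- The Mayer-Vietoris sequence starts with an injection in an initial degree. -/
theorem injective_of_not_rel (H : IsMayerVietorisSquare f f' g g') {i : ι}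
    (hi : ¬ c.Rel (c.prev i) i) :
    Function.Injective
      ((HomologicalComplex.homologyMap f i).hom.prod
        (HomologicalComplex.homologyMap f' i).hom) := by
  rw [injective_iff_map_eq_zero]
  intro a ha
  obtain ⟨p, rfl⟩ := homologyClass_surjective P i a
  have h1 : HomologicalComplex.homologyMap f i (homologyClass P i p) = 0 := congrArg Prod.fst ha
  have h2 : HomologicalComplex.homologyMap f' i (homologyClass P i p) = 0 := congrArg Prod.snd ha
  rw [homologyMap_homologyClass, homologyClass_eq_zero_iff _ rfl] at h1 h2
  rw [Q.shape _ _ hi] at h1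
  rw [Q'.shape _ _ hi] at h2
  obtain ⟨q, hq⟩ := h1
  obtain ⟨q', hq'⟩ := h2
  obtain ⟨p', -, -, h⟩ := H.acyclic_ker _ i _ rfl rfl p.1 hq.symm hq'.symm
    ((mem_cycleSubgroup P rfl).1 p.2)
  exact (homologyClass_eq_zero_iff P rfl p).2 ⟨p', h⟩

/-- The Mayer-Vietoris sequence ends with a surjection in a final degree. -/
theorem surjective_of_not_rel (H : IsMayerVietorisSquare f f' g g') {i : ι}
    (hi : ¬ c.Rel i (c.next i)) :
    Function.Surjective
      ((HomologicalComplex.homologyMap g i).hom.comp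
          (AddMonoidHom.fst (Q.homology i) (Q'.homology i)) -
        (HomologicalComplex.homologyMap g' i).hom.comp
          (AddMonoidHom.snd (Q.homology i) (Q'.homology i))) := by
  intro a
  obtain ⟨r, rfl⟩ := homologyClass_surjective R i a
  obtain ⟨r', q, q', h⟩ := H.acyclic_coker _ i _ rfl rfl r.1 0 0
    (by rw [map_zero, map_zero, sub_zero, (mem_cycleSubgroup R rfl).1 r.2])
  refine ⟨(homologyClass Q i ⟨q, ?_⟩, homologyClass Q' i ⟨q', ?_⟩), ?_⟩
  · rw [mem_cycleSubgroup Q rfl, Q.shape _ _ hi]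
    rfl
  · rw [mem_cycleSubgroup Q' rfl, Q'.shape _ _ hi]
    rfl
  · change HomologicalComplex.homologyMap g i (homologyClass Q i _) -
      HomologicalComplex.homologyMap g' i (homologyClass Q' i _) = _
    rw [homologyMap_homologyClass, homologyMap_homologyClass, ← map_sub, eq_comm,
      homologyClass_eq_iff rfl]
    refine ⟨r', ?_⟩
    change _ = r.1 - (g.f i q - g'.f i q')
    rw [h]
    abel

end IsMayerVietorisSquare

end MayerVietoris

/-! ### Affine simplices in the standard simplex and their diameters -/

section AffineSimplices

/-- An affine `k`-simplex in the standard `n`-simplex, given by its vertices. -/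
abbrev AffineSimplex (k n : ℕ) : Type := Fin (k + 1) → stdSimplex ℝ (Fin (n + 1))

namespace AffineSimplex

variable {k l m n : ℕ}

/-- The affine map with prescribed vertices. -/
def toMap (v : AffineSimplex k n) : C(stdSimplex ℝ (Fin (k + 1)), stdSimplex ℝ (Fin (n + 1))) where
  toFun x := ⟨∑ i, x i • (v i : Fin (n + 1) → ℝ),
    (convex_stdSimplex ℝ _).sum_mem (fun i _ => x.2.1 i) x.2.2 fun i _ => (v i).2⟩
  continuous_toFun := by
    refine Continuous.subtype_mk (continuous_finsetSum _ fun i _ => ?_) _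
    exact ((continuous_apply i).comp continuous_subtype_val).smul continuous_const

theorem toMap_apply (v : AffineSimplex k n) (x : stdSimplex ℝ (Fin (k + 1))) (a : Fin (n + 1)) :
    v.toMap x a = ∑ i, x i * v i a := by
  change (∑ i, x i • (v i : Fin (n + 1) → ℝ)) a = _
  rw [Finset.sum_apply]
  rfl

theorem toMap_vertex (v : AffineSimplex k n) (i : Fin (k + 1)) :
    v.toMap (stdSimplex.vertex i) = v i := by
  ext a
  simp [toMap_apply, Pi.single_apply]

/-- Composition of affine simplices. -/
def comp (v : AffineSimplex k m) (w : AffineSimplex m n) : AffineSimplex k n :=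
  fun i => w.toMap (v i)

theorem toMap_comp (v : AffineSimplex k m) (w : AffineSimplex m n) :
    (v.comp w).toMap = w.toMap.comp v.toMap := by
  ext x a
  simp only [toMap_apply, comp, ContinuousMap.comp_apply, Finset.mul_sum, Finset.sum_mul]
  rw [Finset.sum_comm]
  exact Finset.sum_congr rfl fun i _ => Finset.sum_congr rfl fun j _ => (mul_assoc _ _ _).symm

theorem comp_assoc (v : AffineSimplex k l) (w : AffineSimplex l m) (z : AffineSimplex m n) :
    (v.comp w).comp z = v.comp (w.comp z) := by
  funext i
  simp only [comp, toMap_comp, ContinuousMap.comp_apply]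

/-- The identity affine simplex. -/
def id (n : ℕ) : AffineSimplex n n := fun i => stdSimplex.vertex i

theorem id_comp (v : AffineSimplex k n) : (id k).comp v = v := funext fun i => toMap_vertex v i

theorem toMap_id : (id n).toMap = ContinuousMap.id _ := by
  ext x a
  simp [toMap_apply, id, Pi.single_apply]

theorem comp_id (v : AffineSimplex k n) : v.comp (id n) = v := by
  funext i
  simp only [comp, toMap_id, ContinuousMap.id_apply]

/-- The faces of the standard simplex. -/
def face (j : Fin (n + 2)) : AffineSimplex n (n + 1) := fun i => stdSimplex.vertex (j.succAbove i)

theorem face_comp (j : Fin (k + 2)) (v : AffineSimplex (k + 1) n) :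
    (face j).comp v = fun i => v (j.succAbove i) := funext fun _ => toMap_vertex v _

theorem toMap_face_apply (j : Fin (n + 2)) (x : stdSimplex ℝ (Fin (n + 1))) (a : Fin (n + 2)) :
    (face j).toMap x a = ∑ i, if j.succAbove i = a then x i else 0 := by
  rw [toMap_apply]
  refine Finset.sum_congr rfl fun i _ => ?_
  simp [face, Pi.single_apply, eq_comm]

theorem toMap_face (j : Fin (n + 2)) :
    (face j).toMap = ⟨stdSimplex.map j.succAbove, stdSimplex.continuous_map _⟩ := by
  ext x a
  rw [toMap_face_apply]
  simp [FunOnFinite.linearMap_apply_apply, Finset.sum_filter]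

theorem toMap_face_succAbove (j : Fin (n + 2)) (x : stdSimplex ℝ (Fin (n + 1))) (a : Fin (n + 1)) :
    (face j).toMap x (j.succAbove a) = x a := by
  simp [toMap_face_apply]

/-- The cone over an affine simplex. -/
def cone (b : stdSimplex ℝ (Fin (n + 1))) (v : AffineSimplex k n) : AffineSimplex (k + 1) n :=
  Fin.cons b v

theorem face_zero_comp_cone (b : stdSimplex ℝ (Fin (n + 1))) (v : AffineSimplex k n) :
    (face 0).comp (cone b v) = v := by
  rw [face_comp]
  funext i
  simp [cone]

theorem face_succ_comp_cone (b : stdSimplex ℝ (Fin (n + 1))) (v : AffineSimplex (k + 1) n)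
    (j : Fin (k + 2)) : (face j.succ).comp (cone b v) = cone b ((face j).comp v) := by
  rw [face_comp, face_comp]
  funext i
  refine Fin.cases ?_ (fun i => ?_) i <;> simp [cone]

/-- The affine simplices all whose vertices have weight at least `1 / (n + 1)` at a common vertex
of the standard simplex. -/
def pinned (k n : ℕ) : Set (AffineSimplex k n) :=
  {v | ∃ a, ∀ i, 1 / ((n : ℝ) + 1) ≤ v i a}

/-- The affine simplices of diameter at most `r`. -/
def diamLE (k n : ℕ) (r : ℝ) : Set (AffineSimplex k n) :=
  {v | ∀ i j a, v i a - v j a ≤ r}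

/-- The weight `δ` that both means put on `f a` cancels. What is left of either has total weight `1
- δ`, and the values of `f` lie between its minimum and the minimum plus `r`. -/
theorem sum_sub_sum_le {ι : Type*} [Fintype ι] [Nonempty ι] [DecidableEq ι] {x y : ι → ℝ}
    (hx : x ∈ stdSimplex ℝ ι) (hy : y ∈ stdSimplex ℝ ι) {δ : ℝ} {a : ι}
    (hxa : δ ≤ x a) (hya : δ ≤ y a) {f : ι → ℝ} {r : ℝ}
    (hf : ∀ i j, f i - f j ≤ r) :
    ∑ i, x i * f i - ∑ i, y i * f i ≤ (1 - δ) * r := by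
  obtain ⟨i₀, hi₀⟩ := Finite.exists_min f
  have h1 : ∑ i, (x i - Pi.single (M := fun _ => ℝ) a δ i) * f i ≤
      ∑ i, (x i - Pi.single (M := fun _ => ℝ) a δ i) * (f i₀ + r) := by
    refine Finset.sum_le_sum fun i _ => mul_le_mul_of_nonneg_left ?_ ?_
    · linarith [hf i i₀]
    · by_cases h : i = a
      · subst h
        simpa using hxa
      · simpa [h] using hx.1 i
  have h2 : ∑ i, (y i - Pi.single (M := fun _ => ℝ) a δ i) * f i₀ ≤
      ∑ i, (y i - Pi.single (M := fun _ => ℝ) a δ i) * f i := by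
    refine Finset.sum_le_sum fun i _ => mul_le_mul_of_nonneg_left (hi₀ i) ?_
    by_cases h : i = a
    · subst h
      simpa using hya
    · simpa [h] using hy.1 i
  rw [← Finset.sum_mul, Finset.sum_sub_distrib, hx.2] at h1
  rw [← Finset.sum_mul, Finset.sum_sub_distrib, hy.2] at h2
  simp only [sub_mul, Finset.sum_sub_distrib, Finset.sum_pi_single', Finset.mem_univ,
    if_true] at h1 h2
  linarith

/-- Source of the classical contraction factor m/(m+1): all vertices of `v` share weight 1/(m+1) at
one vertex. -/
theorem comp_mem_diamLE {v : AffineSimplex k m} {w : AffineSimplex m n} {r : ℝ}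
    (hv : v ∈ pinned k m) (hw : w ∈ diamLE m n r) :
    v.comp w ∈ diamLE k n ((1 - 1 / ((m : ℝ) + 1)) * r) := by
  obtain ⟨b, hb⟩ := hv
  intro i j a
  simp only [comp, toMap_apply]
  exact sum_sub_sum_le (v i).2 (v j).2 (hb i) (hb j) fun i j => hw i j a

theorem dist_toMap_le {v : AffineSimplex k n} {r : ℝ} (hv : v ∈ diamLE k n r)
    (x y : stdSimplex ℝ (Fin (k + 1))) : dist (v.toMap x) (v.toMap y) ≤ r := by
  have hr : 0 ≤ r := by simpa using hv 0 0 0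
  have key : ∀ (x y : stdSimplex ℝ (Fin (k + 1))) a, v.toMap x a - v.toMap y a ≤ r := by
    intro x y a
    rw [toMap_apply, toMap_apply]
    -- The shared weight is taken to be `δ = 0`, so no contraction is claimed.
    have := sum_sub_sum_le x.2 y.2 (x.2.1 0) (y.2.1 0) fun i j => hv i j a
    rwa [sub_zero, one_mul] at this
  refine (dist_pi_le_iff hr).2 fun a => ?_
  rw [Real.dist_eq, abs_le]
  constructor
  · have := key y x a
    change _ ≤ v.toMap x a - v.toMap y a
    linarith
  · exact key x y a

/-- A face inclusion keeps the weights, while the required bound drops to 1/(n+2). -/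
theorem comp_face_mem_pinned {v : AffineSimplex k n} (hv : v ∈ pinned k n) (j : Fin (n + 2)) :
    v.comp (face j) ∈ pinned k (n + 1) := by
  obtain ⟨a, ha⟩ := hv
  refine ⟨j.succAbove a, fun i => ?_⟩
  simp only [comp, toMap_face_succAbove]
  refine le_trans ?_ (ha i)
  push_cast
  apply one_div_le_one_div_of_le <;> linarith [(Nat.cast_nonneg n : (0 : ℝ) ≤ n)]

/-- The barycenter has weight exactly 1/(n+1) at every vertex, in particular at the one where `v` is
pinned. -/
theorem cone_barycenter_mem_pinned {v : AffineSimplex k n} (hv : v ∈ pinned k n) :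
    cone stdSimplex.barycenter v ∈ pinned (k + 1) n := by
  obtain ⟨a, ha⟩ := hv
  refine ⟨a, fun i => ?_⟩
  refine Fin.cases ?_ (fun i => ?_) i
  · change _ ≤ ((Fintype.card (Fin (n + 1)) : ℝ))⁻¹
    simp
  · simpa [cone] using ha i

end AffineSimplex

/-! ### Affine chains: composition, boundary and cone -/

/-- Formal sums of affine `k`-simplices in the standard `n`-simplex. -/
abbrev AffineChain (k n : ℕ) : Type := AffineSimplex k n →₀ ℤ

namespace AffineChain

variable {k l m n : ℕ}

/-- The affine chain given by one simplex. -/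
abbrev of (v : AffineSimplex k n) : AffineChain k n := Finsupp.single v 1

/-- Linear extension of a function on affine simplices. -/
def lift {G : Type*} [AddCommGroup G] (f : AffineSimplex k n → G) : AffineChain k n →+ G :=
  Finsupp.liftAddHom fun v => zmultiplesHom G (f v)

theorem lift_single {G : Type*} [AddCommGroup G] (f : AffineSimplex k n → G)
    (v : AffineSimplex k n) (z : ℤ) : lift f (Finsupp.single v z) = z • f v := by
  simp [lift]

@[simp]
theorem lift_of {G : Type*} [AddCommGroup G] (f : AffineSimplex k n → G)
    (v : AffineSimplex k n) : lift f (of v) = f v := by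
  rw [lift_single, one_smul]

theorem lift_eq_sum {G : Type*} [AddCommGroup G] (f : AffineSimplex k n → G)
    (x : AffineChain k n) : lift f x = ∑ v ∈ x.support, x v • f v := by
  simp [lift, Finsupp.sum]

-- Coefficients are integers, so sums and negatives of simplices reach every chain; additive
-- identities need checking only on simplices.
@[elab_as_elim]
theorem induction {p : AffineChain k n → Prop} (x : AffineChain k n) (zero : p 0)
    (add : ∀ x y, p x → p y → p (x + y)) (neg : ∀ x, p x → p (-x)) (of : ∀ v, p (of v)) : p x := by
  induction x using Finsupp.induction_linear with
  | zero => exact zero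
  | add x y hx hy => exact add x y hx hy
  | single v z =>
    have key : ∀ m : ℕ, p (Finsupp.single v (m : ℤ)) := by
      intro m
      induction m with
      | zero => simpa using zero
      | succ m hm =>
        rw [Nat.cast_succ, Finsupp.single_add]
        exact add _ _ hm (of v)
    obtain ⟨m, rfl | rfl⟩ := z.eq_nat_or_neg
    · exact key m
    · rw [Finsupp.single_neg]
      exact neg _ (key m)

/-- The bilinear extension of the composition of affine simplices. -/
def compHom : AffineChain k m →+ AffineChain m n →+ AffineChain k n :=
  lift fun v => lift fun w => of (v.comp w)

/-- Composition of affine chains. -/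
def comp (x : AffineChain k m) (y : AffineChain m n) : AffineChain k n := compHom x y

theorem comp_of_of (v : AffineSimplex k m) (w : AffineSimplex m n) :
    comp (of v) (of w) = of (v.comp w) := by
  simp [comp, compHom]

theorem add_comp (x y : AffineChain k m) (z : AffineChain m n) :
    comp (x + y) z = comp x z + comp y z := by simp [comp]

theorem comp_add (x : AffineChain k m) (y z : AffineChain m n) :
    comp x (y + z) = comp x y + comp x z := by simp [comp]

theorem neg_comp (x : AffineChain k m) (y : AffineChain m n) :
    comp (-x) y = -comp x y := by simp [comp]

theorem comp_neg (x : AffineChain k m) (y : AffineChain m n) :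
    comp x (-y) = -comp x y := by simp [comp]

theorem sub_comp (x y : AffineChain k m) (z : AffineChain m n) :
    comp (x - y) z = comp x z - comp y z := by simp [comp]

theorem comp_sub (x : AffineChain k m) (y z : AffineChain m n) :
    comp x (y - z) = comp x y - comp x z := by simp [comp]

theorem comp_zero (x : AffineChain k m) : comp x (0 : AffineChain m n) = 0 := by simp [comp]

theorem zero_comp (x : AffineChain m n) : comp (0 : AffineChain k m) x = 0 := by simp [comp]

theorem comp_assoc (x : AffineChain k l) (y : AffineChain l m) (z : AffineChain m n) :
    comp (comp x y) z = comp x (comp y z) := by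
  induction x using induction with
  | zero => simp only [zero_comp]
  | add x x' hx hx' => simp only [add_comp, hx, hx']
  | neg x hx => simp only [neg_comp, hx]
  | of v =>
    induction y using induction with
    | zero => simp only [zero_comp, comp_zero]
    | add x x' hx hx' => simp only [comp_add, add_comp, hx, hx']
    | neg x hx => simp only [neg_comp, comp_neg, hx]
    | of w =>
      induction z using induction with
      | zero => simp only [comp_zero]
      | add x x' hx hx' => simp only [comp_add, hx, hx']
      | neg x hx => simp only [comp_neg, hx]
      | of z => simp only [comp_of_of, AffineSimplex.comp_assoc]

/-- The identity affine chain. -/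
abbrev id (n : ℕ) : AffineChain n n := of (AffineSimplex.id n)

theorem id_comp (x : AffineChain k n) : comp (id k) x = x := by
  induction x using induction with
  | zero => exact comp_zero _
  | add x x' hx hx' => rw [comp_add, hx, hx']
  | neg x hx => rw [comp_neg, hx]
  | of v => rw [comp_of_of, AffineSimplex.id_comp]

theorem comp_id (x : AffineChain k n) : comp x (id n) = x := by
  induction x using induction with
  | zero => exact zero_comp _
  | add x x' hx hx' => rw [add_comp, hx, hx']
  | neg x hx => rw [neg_comp, hx]
  | of v => rw [comp_of_of, AffineSimplex.comp_id]

theorem sum_comp {ι : Type*} (s : Finset ι) (x : ι → AffineChain k m) (y : AffineChain m n) :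
    comp (∑ i ∈ s, x i) y = ∑ i ∈ s, comp (x i) y := by
  simp [comp]

theorem comp_sum {ι : Type*} (s : Finset ι) (x : AffineChain k m) (y : ι → AffineChain m n) :
    comp x (∑ i ∈ s, y i) = ∑ i ∈ s, comp x (y i) := by
  simp [comp]

theorem zsmul_comp (z : ℤ) (x : AffineChain k m) (y : AffineChain m n) :
    comp (z • x) y = z • comp x y := by
  simp only [comp, map_zsmul, AddMonoidHom.coe_smul, Pi.smul_apply]

theorem comp_zsmul (z : ℤ) (x : AffineChain k m) (y : AffineChain m n) :
    comp x (z • y) = z • comp x y := by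
  simp only [comp, map_zsmul]

/-- The boundary of the standard simplex. -/
def bd (n : ℕ) : AffineChain n (n + 1) :=
  ∑ j : Fin (n + 2), (-1 : ℤ) ^ (j : ℕ) • of (AffineSimplex.face j)

theorem bd_comp (x : AffineChain (k + 1) n) :
    comp (bd k) x = ∑ j : Fin (k + 2), (-1 : ℤ) ^ (j : ℕ) • comp (of (AffineSimplex.face j)) x := by
  simp only [bd, sum_comp, zsmul_comp]

theorem bd_comp_bd (n : ℕ) : comp (bd n) (bd (n + 1)) = 0 := by
  rw [bd, sum_comp]
  simp only [bd, comp_sum, zsmul_comp, comp_zsmul, smul_smul, comp_of_of]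
  refine Eq.trans (by simp only [mul_comm]) (alternating_sum_eq_zero n (fun i j =>
    of ((AffineSimplex.face i).comp (AffineSimplex.face j))) fun i j hij => ?_)
  congr 1
  funext k
  rw [AffineSimplex.face_comp, AffineSimplex.face_comp]
  simp only [AffineSimplex.face]
  congr 1
  have := congrArg (fun f : SimplexCategory.mk n ⟶ SimplexCategory.mk (n + 2) =>
    f.toOrderHom k) (SimplexCategory.δ_comp_δ hij)
  simpa [SimplexCategory.δ] using this

/-- The linear extension of the cone. -/
def cone (b : stdSimplex ℝ (Fin (n + 1))) : AffineChain k n →+ AffineChain (k + 1) n :=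
  lift fun v => of (v.cone b)

theorem cone_of (b : stdSimplex ℝ (Fin (n + 1))) (v : AffineSimplex k n) :
    cone b (of v) = of (v.cone b) := lift_of _ _

/-- Face `0` of a cone is its base; the other faces are the cones over the faces of the base, with
the sign shifted by one. Left composition with `bd` is the boundary of a chain, right composition
transports a chain to the faces of a larger simplex. -/
theorem bd_comp_cone (b : stdSimplex ℝ (Fin (n + 1))) (x : AffineChain (k + 1) n) :
    comp (bd (k + 1)) (cone b x) = x - cone b (comp (bd k) x) := by
  induction x using induction with
  | zero => simp only [map_zero, comp_zero, sub_zero]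
  | add x x' hx hx' => rw [map_add, comp_add, hx, hx', comp_add, map_add]; abel
  | neg x hx => rw [map_neg, comp_neg, hx, comp_neg, map_neg]; abel
  | of v =>
    rw [bd_comp, bd_comp, Fin.sum_univ_succ]
    simp only [cone_of, comp_of_of, AffineSimplex.face_zero_comp_cone,
      AffineSimplex.face_succ_comp_cone, map_sum, map_zsmul, Fin.val_zero, pow_zero, one_smul,
      Fin.val_succ, pow_succ, mul_neg_one, neg_smul, Finset.sum_neg_distrib]
    rw [sub_eq_add_neg]

/-- The augmentation. -/
def augmentation : AffineChain k n →+ ℤ := lift fun _ => 1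

/-- In degree zero the second face of a cone is the apex, which contributes one copy of `b` for each
unit of augmentation. -/
theorem bd_zero_comp_cone (b : stdSimplex ℝ (Fin (n + 1))) (x : AffineChain 0 n) :
    comp (bd 0) (cone b x) = x - augmentation x • of fun _ => b := by
  induction x using induction with
  | zero => simp only [map_zero, comp_zero, zero_smul, sub_zero]
  | add x x' hx hx' => rw [map_add, comp_add, hx, hx', map_add, add_smul]; abel
  | neg x hx => rw [map_neg, comp_neg, hx, map_neg, neg_smul]; abel
  | of v =>
    have : (AffineSimplex.face 1).comp (v.cone b) = fun _ => b := by
      rw [AffineSimplex.face_comp]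
      funext i
      obtain rfl : i = 0 := Fin.ext (by omega)
      rfl
    rw [bd_comp, Fin.sum_univ_two]
    simp [cone_of, comp_of_of, AffineSimplex.face_zero_comp_cone, this, augmentation,
      sub_eq_add_neg]

/-- The affine chains all whose simplices lie in `P`. -/
def supportedIn (P : Set (AffineSimplex k n)) : AddSubgroup (AffineChain k n) where
  carrier := {x | ∀ v ∈ x.support, v ∈ P}
  zero_mem' := by simp
  add_mem' {x y} hx hy v hv := by
    classical
    rcases Finset.mem_union.1 (Finsupp.support_add hv) with h | h
    exacts [hx v h, hy v h]
  neg_mem' {x} hx v hv := hx v (by rwa [Finsupp.support_neg] at hv)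

theorem of_mem_supportedIn {P : Set (AffineSimplex k n)} {v : AffineSimplex k n} (hv : v ∈ P) :
    of v ∈ supportedIn P := by
  intro w hw
  obtain rfl := Finset.mem_singleton.1 (Finsupp.support_single_subset hw)
  exact hv

theorem lift_mem {G : Type*} [AddCommGroup G] {f : AffineSimplex k n → G} {S : AddSubgroup G}
    {P : Set (AffineSimplex k n)} {x : AffineChain k n} (hx : x ∈ supportedIn P)
    (hf : ∀ v ∈ P, f v ∈ S) : lift f x ∈ S := by
  rw [lift_eq_sum]
  exact sum_mem fun v hv => S.zsmul_mem (hf v (hx v hv)) _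

theorem comp_mem_supportedIn {P : Set (AffineSimplex k m)} {P' : Set (AffineSimplex m n)}
    {P'' : Set (AffineSimplex k n)} {x : AffineChain k m} {y : AffineChain m n}
    (hx : x ∈ supportedIn P) (hy : y ∈ supportedIn P')
    (h : ∀ v ∈ P, ∀ w ∈ P', v.comp w ∈ P'') : comp x y ∈ supportedIn P'' := by
  rw [comp, compHom, lift_eq_sum, AddMonoidHom.finsetSum_apply]
  refine sum_mem fun v hv => ?_
  rw [AddMonoidHom.smul_apply]
  exact AddSubgroup.zsmul_mem _
    (lift_mem hy fun w hw => of_mem_supportedIn (h v (hx v hv) w hw)) _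

/-! ### Barycentric subdivision, its homotopy to the identity, and its iterates -/

/-- The barycentric subdivision of the standard simplex. -/
def sd : ∀ n, AffineChain n n
  | 0 => id 0
  | n + 1 => cone stdSimplex.barycenter (comp (sd n) (bd n))

/-- The chain homotopy from the barycentric subdivision to the identity. -/
def sdHomotopy : ∀ n, AffineChain (n + 1) n
  | 0 => 0
  | n + 1 => cone stdSimplex.barycenter (id (n + 1) - sd (n + 1) - comp (sdHomotopy n) (bd n))

theorem sd_zero : sd 0 = id 0 := rfl

theorem sd_succ (n : ℕ) :
    sd (n + 1) = cone stdSimplex.barycenter (comp (sd n) (bd n)) := rfl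

theorem sdHomotopy_zero : sdHomotopy 0 = 0 := rfl

theorem sdHomotopy_succ (n : ℕ) :
    sdHomotopy (n + 1) =
      cone stdSimplex.barycenter (id (n + 1) - sd (n + 1) - comp (sdHomotopy n) (bd n)) := rfl

/-- The cone formula leaves the cone over the boundary of the subdivided boundary, which vanishes by
induction and `bd_comp_bd`. In the lowest degree the apex terms cancel because a boundary has
augmentation zero. -/
theorem bd_comp_sd (n : ℕ) : comp (bd n) (sd (n + 1)) = comp (sd n) (bd n) := by
  induction n with
  | zero =>
    rw [sd_succ, bd_zero_comp_cone, sd_zero, id_comp]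
    simp [bd, augmentation, Fin.sum_univ_two]
  | succ n ih =>
    rw [sd_succ, bd_comp_cone, ← comp_assoc, ih, comp_assoc, bd_comp_bd, comp_zero, map_zero,
      sub_zero]

/-- The chain being coned off is a cycle, by induction and `bd_comp_sd`, so the boundary of the cone
is that chain. -/
theorem bd_comp_sdHomotopy (n : ℕ) :
    comp (bd (n + 1)) (sdHomotopy (n + 1)) =
      id (n + 1) - sd (n + 1) - comp (sdHomotopy n) (bd n) := by
  induction n with
  | zero =>
    rw [sdHomotopy_succ, bd_comp_cone]
    simp only [comp_sub, bd_comp_sd, comp_id, sd_zero, id_comp, sdHomotopy_zero, zero_comp,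
      sub_self, map_zero, sub_zero]
  | succ n ih =>
    rw [sdHomotopy_succ, bd_comp_cone, comp_sub, comp_sub, ← comp_assoc, ih, comp_id, bd_comp_sd,
      sub_comp, sub_comp, comp_assoc, bd_comp_bd, comp_zero, sub_zero, id_comp, sub_self, map_zero,
      sub_zero]

/-- The vertices of a simplex of the subdivision are barycenters of a flag of faces, and the
smallest face is a vertex common to all of them. -/
theorem sd_mem_supportedIn_pinned (n : ℕ) : sd n ∈ supportedIn (AffineSimplex.pinned n n) := by
  induction n with
  | zero =>
    refine of_mem_supportedIn ⟨0, fun i => ?_⟩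
    obtain rfl : i = 0 := Fin.ext (by omega)
    simp [AffineSimplex.id]
  | succ n ih =>
    refine lift_mem (P := AffineSimplex.pinned n (n + 1)) ?_ fun v hv =>
      of_mem_supportedIn (AffineSimplex.cone_barycenter_mem_pinned hv)
    rw [bd, comp_sum]
    refine sum_mem fun j _ => ?_
    rw [comp_zsmul]
    exact AddSubgroup.zsmul_mem _ (comp_mem_supportedIn ih (of_mem_supportedIn (mem_singleton _))
      fun v hv w hw => by
        rw [mem_singleton_iff.1 hw]
        exact AffineSimplex.comp_face_mem_pinned hv j) _

/-- The iterated barycentric subdivision. -/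
def sdIter (n : ℕ) : ℕ → AffineChain n n
  | 0 => id n
  | m + 1 => comp (sd n) (sdIter n m)

theorem sdIter_zero (n : ℕ) : sdIter n 0 = id n := rfl

theorem sdIter_succ (n m : ℕ) : sdIter n (m + 1) = comp (sd n) (sdIter n m) := rfl

theorem sdIter_succ' (n m : ℕ) : sdIter n (m + 1) = comp (sdIter n m) (sd n) := by
  induction m with
  | zero => rw [sdIter_succ, sdIter_zero, id_comp, comp_id]
  | succ m ih => rw [sdIter_succ, ih, ← comp_assoc, ← sdIter_succ, ih]

theorem bd_comp_sdIter (n m : ℕ) : comp (bd n) (sdIter (n + 1) m) = comp (sdIter n m) (bd n) := by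
  induction m with
  | zero => rw [sdIter_zero, sdIter_zero, id_comp, comp_id]
  | succ m ih => rw [sdIter_succ, ← comp_assoc, bd_comp_sd, comp_assoc, ih, ← comp_assoc,
      ← sdIter_succ]

theorem sdIter_mem_supportedIn (n m : ℕ) :
    sdIter n m ∈ supportedIn (AffineSimplex.diamLE n n ((1 - 1 / ((n : ℝ) + 1)) ^ m)) := by
  induction m with
  | zero =>
    refine of_mem_supportedIn fun i j a => ?_
    rw [pow_zero]
    have h1 := (AffineSimplex.id n i).2.1 a
    have h2 := (mem_Icc_of_mem_stdSimplex (AffineSimplex.id n i).2 a).2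
    have h3 := (AffineSimplex.id n j).2.1 a
    change (AffineSimplex.id n i).1 a - (AffineSimplex.id n j).1 a ≤ 1
    linarith
  | succ m ih =>
    refine comp_mem_supportedIn (sd_mem_supportedIn_pinned n) ih fun v hv w hw => ?_
    rw [pow_succ']
    exact AffineSimplex.comp_mem_diamLE hv hw

end AffineChain

end AffineSimplices

/-! ### Small simplices and equicontinuous families -/

section SmallSimplices

variable {X : Type u} [MetricSpace X]

/-- Restriction of singular simplices along an affine simplex of the standard simplex. -/
def precomp {k n : ℕ} (v : AffineSimplex k n) (σ : Simplex n X) : Simplex k X := σ.comp v.toMap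

theorem preservesUniform_precomp {k n : ℕ} (v : AffineSimplex k n) :
    PreservesUniform (precomp v : Simplex n X → Simplex k X) := fun ι σ h => by
  constructor
  · intro r hr
    obtain ⟨K, hK⟩ := h.locallyFinite r hr
    refine ⟨K, fun x => le_trans (encard_le_encard ?_) (hK x)⟩
    rintro i ⟨_, hy, ⟨z, rfl⟩⟩
    exact ⟨_, hy, ⟨_, rfl⟩⟩
  · exact fun x U hU => (v.toMap.continuous.tendsto x).eventually (h.equicontinuous _ U hU)

theorem precomp_face {n : ℕ} (j : Fin (n + 2)) :
    (precomp (AffineSimplex.face j) : Simplex (n + 1) X → Simplex n X) = face j := by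
  funext σ
  rw [precomp, AffineSimplex.toMap_face]
  rfl

theorem precomp_comp {k m n : ℕ} (v : AffineSimplex k m) (w : AffineSimplex m n) (σ : Simplex n X) :
    precomp (v.comp w) σ = precomp v (precomp w σ) := by
  rw [precomp, AffineSimplex.toMap_comp]
  rfl

theorem precomp_id {n : ℕ} (σ : Simplex n X) : precomp (AffineSimplex.id n) σ = σ := by
  rw [precomp, AffineSimplex.toMap_id]
  rfl

/-- A simplex is small with respect to `𝒰` if it is contained in a member of `𝒰`. -/
def IsSmall {n : ℕ} (𝒰 : Set (Set X)) (σ : Simplex n X) : Prop := ∃ W ∈ 𝒰, range σ ⊆ W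

theorem IsSmall.precomp {k n : ℕ} {𝒰 : Set (Set X)} {σ : Simplex n X} (h : IsSmall 𝒰 σ)
    (v : AffineSimplex k n) : IsSmall 𝒰 (precomp v σ) := by
  obtain ⟨W, hW, hσ⟩ := h
  exact ⟨W, hW, (range_comp_subset_range v.toMap σ).trans hσ⟩

/-- The gap between `r` and `ε` makes the diameter, a supremum, strictly less than `ε`. -/
theorem isSmall_of_forall_dist_le {n : ℕ} {𝒰 : Set (Set X)} {ε r : ℝ} (h𝒰 : HasLebesgueNumber 𝒰 ε)
    (hε : 0 < ε) (hr : r < ε) {σ : Simplex n X} (hσ : ∀ x y, dist (σ x) (σ y) ≤ r) :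
    IsSmall 𝒰 σ := by
  refine h𝒰 _ (lt_of_le_of_lt (Metric.ediam_le ?_) ((ENNReal.ofReal_lt_ofReal_iff hε).2 hr))
  rintro _ ⟨x, rfl⟩ _ ⟨y, rfl⟩
  rw [edist_dist]
  exact ENNReal.ofReal_le_ofReal (hσ x y)

theorem isSmall_zero {𝒰 : Set (Set X)} {ε : ℝ} (h𝒰 : HasLebesgueNumber 𝒰 ε) (hε : 0 < ε)
    (σ : Simplex 0 X) : IsSmall 𝒰 σ :=
  isSmall_of_forall_dist_le h𝒰 hε hε fun x y => by
    have : Subsingleton (stdSimplex ℝ (Fin (0 + 1))) :=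
      inferInstanceAs (Subsingleton (stdSimplex ℝ (Fin 1)))
    rw [Subsingleton.elim x y, dist_self]

/-- The simplices of sufficiently fine iterated subdivisions of the members of an equicontinuous
family are small. -/
theorem exists_isSmall_of_diamLE {n : ℕ} {𝒰 : Set (Set X)} {ε : ℝ} (h𝒰 : HasLebesgueNumber 𝒰 ε)
    (hε : 0 < ε) {ι : Type*} {σ : ι → Simplex n X}
    (hσ : Equicontinuous fun i => (σ i : stdSimplex ℝ (Fin (n + 1)) → X)) :
    ∃ M : ℕ, ∀ m, M ≤ m → ∀ v ∈ AffineSimplex.diamLE n n ((1 - 1 / ((n : ℝ) + 1)) ^ m),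
      ∀ i, IsSmall 𝒰 (precomp v (σ i)) := by
  have hn : (0 : ℝ) < (n : ℝ) + 1 := by positivity
  have hq0 : 0 ≤ 1 - 1 / ((n : ℝ) + 1) := by
    rw [sub_nonneg, div_le_one hn]
    linarith [(Nat.cast_nonneg n : (0 : ℝ) ≤ n)]
  have hq1 : 1 - 1 / ((n : ℝ) + 1) < 1 := by
    rw [sub_lt_self_iff]
    positivity
  -- Compactness of the standard simplex gives one `δ` for all members and all points, hence one
  -- exponent `M` for the whole family.
  obtain ⟨δ, hδ, H⟩ := Metric.uniformEquicontinuous_iff.1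
    (CompactSpace.uniformEquicontinuous_of_equicontinuous hσ) (ε / 2) (half_pos hε)
  obtain ⟨M, hM⟩ := exists_pow_lt_of_lt_one hδ hq1
  refine ⟨M, fun m hm v hv i => isSmall_of_forall_dist_le h𝒰 hε (half_lt_self hε) fun x y => ?_⟩
  refine (H _ _ (lt_of_le_of_lt (AffineSimplex.dist_toMap_le hv x y) ?_) i).le
  exact lt_of_le_of_lt (pow_le_pow_of_le_one hq0 hq1.le hm) hM

end SmallSimplices

/-! ### Acyclicity of the cochains that vanish on small simplices -/

section CochainAction

variable (A : Type v) [SeminormedAddCommGroup A] {X : Type u} [MetricSpace X]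

/-- The action of affine chains on uniform bounded cochains. -/
def pullChain {k n : ℕ} : AffineChain k n →+ (UBCochain A X k →+ UBCochain A X n) :=
  AffineChain.lift fun v => pull A (precomp v) (preservesUniform_precomp v)

theorem pullChain_of {k n : ℕ} (v : AffineSimplex k n) :
    pullChain A (X := X) (AffineChain.of v) = pull A (precomp v) (preservesUniform_precomp v) :=
  AffineChain.lift_of _ _

theorem pullChain_comp {k m n : ℕ} (x : AffineChain k m) (y : AffineChain m n)
    (w : UBCochain A X k) : pullChain A (x.comp y) w = pullChain A y (pullChain A x w) := by
  induction x using AffineChain.induction with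
  | zero => simp only [AffineChain.zero_comp, map_zero, AddMonoidHom.zero_apply]
  | add x x' hx hx' => simp only [AffineChain.add_comp, map_add, AddMonoidHom.add_apply, hx, hx']
  | neg x hx => simp only [AffineChain.neg_comp, map_neg, AddMonoidHom.neg_apply, hx]
  | of v =>
    induction y using AffineChain.induction with
    | zero => simp only [AffineChain.comp_zero, map_zero, AddMonoidHom.zero_apply]
    | add x x' hx hx' => simp only [AffineChain.comp_add, map_add, AddMonoidHom.add_apply, hx, hx']
    | neg x hx => simp only [AffineChain.comp_neg, map_neg, AddMonoidHom.neg_apply, hx]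
    | of z =>
      rw [AffineChain.comp_of_of, pullChain_of, pullChain_of, pullChain_of]
      ext σ
      exact congrArg w.1 (precomp_comp v z σ)

theorem pullChain_id {n : ℕ} (w : UBCochain A X n) : pullChain A (AffineChain.id n) w = w := by
  rw [pullChain_of]
  ext σ
  exact congrArg w.1 (precomp_id σ)

theorem coboundary_eq_pullChain (n : ℕ) :
    coboundary A X n = pullChain A (AffineChain.bd n) := by
  simp only [coboundary, AffineChain.bd, map_sum, map_zsmul, pullChain_of, precomp_face]

/-- The cochains vanishing on all small simplices. -/
def nullCochains (X : Type u) [MetricSpace X] (𝒰 : Set (Set X)) (n : ℕ) :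
    AddSubgroup (UBCochain A X n) where
  carrier := {w | ∀ σ, IsSmall 𝒰 σ → w.1 σ = 0}
  zero_mem' _ _ := rfl
  add_mem' {w w'} hw hw' σ hσ := by
    change w.1 σ + w'.1 σ = 0
    rw [hw σ hσ, hw' σ hσ, add_zero]
  neg_mem' {w} hw σ hσ := by
    change -w.1 σ = 0
    rw [hw σ hσ, neg_zero]

variable {A}

theorem UBCochain.sum_apply {n : ℕ} {ι : Type*} (s : Finset ι) (f : ι → UBCochain A X n)
    (σ : Simplex n X) : (∑ i ∈ s, f i).1 σ = ∑ i ∈ s, (f i).1 σ := by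
  rw [AddSubgroup.val_finsetSum, Finset.sum_apply]

variable {𝒰 : Set (Set X)}

theorem pullChain_mem_nullCochains {k n : ℕ} (x : AffineChain k n) {w : UBCochain A X k}
    (hw : w ∈ nullCochains A X 𝒰 k) : pullChain A x w ∈ nullCochains A X 𝒰 n := by
  induction x using AffineChain.induction with
  | zero => rw [map_zero]; exact zero_mem _
  | add x y hx hy => rw [map_add]; exact add_mem hx hy
  | neg x hx => rw [map_neg]; exact neg_mem hx
  | of v =>
    rw [pullChain_of]
    exact fun σ hσ => hw _ (hσ.precomp v)

/-- The exponent depends on the family but not on its members; this makes the infinite sum below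
both meaningful and bounded. -/
theorem exists_pullChain_sdIter_eq_zero {n : ℕ} {ε : ℝ} (h𝒰 : HasLebesgueNumber 𝒰 ε)
    (hε : 0 < ε) {w : UBCochain A X n} (hw : w ∈ nullCochains A X 𝒰 n) {ι : Type*}
    {σ : ι → Simplex n X} (hσ : Equicontinuous fun i => (σ i : stdSimplex ℝ (Fin (n + 1)) → X)) :
    ∃ M : ℕ, ∀ m, M ≤ m → ∀ i, (pullChain A (AffineChain.sdIter n m) w).1 (σ i) = 0 := by
  obtain ⟨M, hM⟩ := exists_isSmall_of_diamLE h𝒰 hε hσ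
  refine ⟨M, fun m hm i => ?_⟩
  have h := AffineChain.sdIter_mem_supportedIn n m
  rw [pullChain, AffineChain.lift_eq_sum, AddMonoidHom.finsetSum_apply, UBCochain.sum_apply]
  refine Finset.sum_eq_zero fun v hv => ?_
  have h0 : w.1 (precomp v (σ i)) = 0 := hw _ (hM m hm v (h v hv) i)
  change (AffineChain.sdIter n m) v • w.1 (precomp v (σ i)) = 0
  rw [h0, smul_zero]

/-- The homotopy formula has a further term, the homotopy applied to the coboundary of `w`, which
vanishes on cocycles. -/
theorem coboundary_pullChain_sdHomotopy {n : ℕ} {w : UBCochain A X (n + 1)}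
    (hw : coboundary A X (n + 1) w = 0) :
    coboundary A X n (pullChain A (AffineChain.sdHomotopy n) w) =
      w - pullChain A (AffineChain.sd (n + 1)) w := by
  have h := AffineChain.bd_comp_sdHomotopy n
  rw [eq_sub_iff_add_eq, ← eq_sub_iff_add_eq'] at h
  rw [coboundary_eq_pullChain] at hw ⊢
  rw [← pullChain_comp, h, map_sub, map_sub, AddMonoidHom.sub_apply, AddMonoidHom.sub_apply,
    pullChain_id, pullChain_comp, hw, map_zero, sub_zero]

/-- The complex of cochains vanishing on small simplices is acyclic. -/
theorem exists_null_coboundary_eq {n : ℕ} {ε : ℝ} (h𝒰 : HasLebesgueNumber 𝒰 ε) (hε : 0 < ε)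
    {w : UBCochain A X (n + 1)} (hw : w ∈ nullCochains A X 𝒰 (n + 1))
    (hdw : coboundary A X (n + 1) w = 0) :
    ∃ v ∈ nullCochains A X 𝒰 n, coboundary A X n v = w := by
  set t := pullChain A (AffineChain.sdHomotopy n) w with ht
  have htn : t ∈ nullCochains A X 𝒰 n := pullChain_mem_nullCochains _ hw
  set f : ℕ → UBCochain A X n := fun i => pullChain A (AffineChain.sdIter n i) t with hf
  -- On an equicontinuous family the terms vanish from a common index on, so the infinite sum is
  -- there a fixed partial sum, itself a uniform bounded cochain.
  have hsum : ∀ {ι : Type u} {σ : ι → Simplex n X},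
      Equicontinuous (fun i => (σ i : stdSimplex ℝ (Fin (n + 1)) → X)) →
      ∃ M : ℕ, ∀ m, M ≤ m → ∀ i, ∑ᶠ j, (f j).1 (σ i) = (∑ j ∈ Finset.range m, f j).1 (σ i) := by
    intro ι σ hσ
    obtain ⟨M, hM⟩ := exists_pullChain_sdIter_eq_zero h𝒰 hε htn hσ
    refine ⟨M, fun m hm i => ?_⟩
    rw [UBCochain.sum_apply]
    refine finsum_eq_sum_of_support_subset _ fun j hj => ?_
    rw [Finset.coe_range, mem_Iio]
    by_contra hj'
    exact hj (hM j (hm.trans (not_lt.1 hj')) i)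
  have hsingle : ∀ {m : ℕ} (σ : Simplex m X),
      Equicontinuous fun _ : PUnit.{u + 1} => (σ : stdSimplex ℝ (Fin (m + 1)) → X) := fun σ =>
    equicontinuous_finite.2 fun _ => σ.continuous
  refine ⟨⟨fun σ => ∑ᶠ j, (f j).1 σ, fun ι σ hσ => ?_⟩, fun σ hσ => ?_, ?_⟩
  · obtain ⟨M, hM⟩ := hsum hσ.equicontinuous
    obtain ⟨C, hC⟩ := (∑ j ∈ Finset.range M, f j).2 ι σ hσ
    refine ⟨C, fun i => ?_⟩
    change ‖∑ᶠ j, (f j).1 (σ i)‖ ≤ C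
    rw [hM M le_rfl]
    exact hC i
  · change ∑ᶠ j, (f j).1 σ = 0
    rw [← finsum_zero]
    exact finsum_congr fun j => pullChain_mem_nullCochains _ htn σ hσ
  · ext σ
    obtain ⟨M, hM⟩ := exists_pullChain_sdIter_eq_zero h𝒰 hε hw (hsingle σ)
    choose N hN using fun j => hsum (hsingle (face j σ))
    -- `L` is large enough for the sum to have stabilised on every face of `σ` and for the
    -- telescoping remainder to vanish on `σ`.
    set L := max M (Finset.univ.sup N) with hL
    have hcomm : ∀ i, coboundary A X n (f i) =
        pullChain A (AffineChain.sdIter (n + 1) i) w -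
          pullChain A (AffineChain.sdIter (n + 1) (i + 1)) w := by
      intro i
      have h1 : coboundary A X n (f i) =
          pullChain A (AffineChain.sdIter (n + 1) i) (coboundary A X n t) := by
        rw [coboundary_eq_pullChain, ← pullChain_comp, ← AffineChain.bd_comp_sdIter,
          pullChain_comp]
      rw [h1, ht, coboundary_pullChain_sdHomotopy hdw, map_sub, ← pullChain_comp,
        AffineChain.sdIter_succ]
    have htel : coboundary A X n (∑ i ∈ Finset.range L, f i) =
        w - pullChain A (AffineChain.sdIter (n + 1) L) w := by
      rw [map_sum, Finset.sum_congr rfl fun i _ => hcomm i, Finset.sum_range_sub',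
        AffineChain.sdIter_zero, pullChain_id]
    have h2 := congrArg (fun z => z.1 σ) htel
    change (coboundary A X n _).1 σ = w.1 σ - (pullChain A _ w).1 σ at h2
    rw [hM L (le_max_left _ _) PUnit.unit, sub_zero, coboundary_apply] at h2
    rw [coboundary_apply, ← h2]
    refine Finset.sum_congr rfl fun j _ => ?_
    congr 1
    exact hN j L ((Finset.le_sup (Finset.mem_univ j)).trans (le_max_right _ _)) PUnit.unit

end CochainAction

/-! ### Replacing chains by small chains -/

section ChainAction

variable (A : Type v) [SeminormedAddCommGroup A] {X : Type u} [MetricSpace X]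

/-- The action of affine chains on uniform bounded chains. -/
def pushChain {k n : ℕ} : AffineChain k n →+ (UBChain A X n →+ UBChain A X k) :=
  AffineChain.lift fun v => push A (precomp v) (preservesUniform_precomp v)

theorem pushChain_of {k n : ℕ} (v : AffineSimplex k n) :
    pushChain A (X := X) (AffineChain.of v) = push A (precomp v) (preservesUniform_precomp v) :=
  AffineChain.lift_of _ _

theorem push_id {Y : Type u} [MetricSpace Y] {n : ℕ} {p : Simplex n Y → Simplex n Y}
    (hp : PreservesUniform p) (h : ∀ σ, p σ = σ) (c : UBChain A Y n) : push A p hp c = c := by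
  obtain rfl : p = _root_.id := funext h
  ext t
  change ∑ᶠ s ∈ ({t} : Set (Simplex n Y)), c.1 s = c.1 t
  rw [finsum_mem_singleton]

theorem pushChain_comp {k m n : ℕ} (x : AffineChain k m) (y : AffineChain m n)
    (c : UBChain A X n) : pushChain A (x.comp y) c = pushChain A x (pushChain A y c) := by
  induction x using AffineChain.induction with
  | zero => simp only [AffineChain.zero_comp, map_zero, AddMonoidHom.zero_apply]
  | add x x' hx hx' => simp only [AffineChain.add_comp, map_add, AddMonoidHom.add_apply, hx, hx']
  | neg x hx => simp only [AffineChain.neg_comp, map_neg, AddMonoidHom.neg_apply, hx]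
  | of v =>
    induction y using AffineChain.induction with
    | zero => simp only [AffineChain.comp_zero, map_zero, AddMonoidHom.zero_apply]
    | add x x' hx hx' => simp only [AffineChain.comp_add, map_add, AddMonoidHom.add_apply, hx, hx']
    | neg x hx => simp only [AffineChain.comp_neg, map_neg, AddMonoidHom.neg_apply, hx]
    | of z =>
      have e : (precomp (v.comp z) : Simplex n X → Simplex k X) = precomp v ∘ precomp z :=
        funext (precomp_comp v z)
      have hvz := preservesUniform_precomp (X := X) (v.comp z)
      rw [e] at hvz
      rw [AffineChain.comp_of_of, pushChain_of, pushChain_of, pushChain_of,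
        ← AddMonoidHom.comp_apply, push_comp A _ _ hvz]
      congr 2

theorem pushChain_id {n : ℕ} (c : UBChain A X n) : pushChain A (AffineChain.id n) c = c := by
  rw [pushChain_of]
  exact push_id A _ precomp_id c

theorem boundary_eq_pushChain (n : ℕ) :
    boundary A X n = pushChain A (AffineChain.bd n) := by
  simp only [boundary, AffineChain.bd, map_sum, map_zsmul, pushChain_of, precomp_face]

/-- The chains whose simplices are small. -/
def smallChains (X : Type u) [MetricSpace X] (𝒰 : Set (Set X)) (n : ℕ) :
    AddSubgroup (UBChain A X n) where
  carrier := {c | ∀ σ, ¬ IsSmall 𝒰 σ → c.1 σ = 0}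
  zero_mem' _ _ := rfl
  add_mem' {w w'} hw hw' σ hσ := by
    change w.1 σ + w'.1 σ = 0
    rw [hw σ hσ, hw' σ hσ, add_zero]
  neg_mem' {w} hw σ hσ := by
    change -w.1 σ = 0
    rw [hw σ hσ, neg_zero]

variable {A}

theorem push_eq_zero {m n : ℕ} {Y : Type u} [MetricSpace Y] {p : Simplex m X → Simplex n Y}
    (hp : PreservesUniform p) {c : UBChain A X m} {t : Simplex n Y}
    (h : ∀ s, p s = t → c.1 s = 0) : (push A p hp c).1 t = 0 :=
  finsum_mem_eq_zero_of_forall_eq_zero fun s hs => h s hs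

variable {𝒰 : Set (Set X)}

theorem pushChain_mem_smallChains {k n : ℕ} (x : AffineChain k n) {c : UBChain A X n}
    (hc : c ∈ smallChains A X 𝒰 n) : pushChain A x c ∈ smallChains A X 𝒰 k := by
  induction x using AffineChain.induction with
  | zero => rw [map_zero]; exact zero_mem _
  | add x y hx hy => rw [map_add]; exact add_mem hx hy
  | neg x hx => rw [map_neg]; exact neg_mem hx
  | of v =>
    rw [pushChain_of]
    refine fun σ hσ => push_eq_zero _ fun τ hτ => hc _ fun h => hσ ?_
    rw [← hτ]
    exact h.precomp v

/-- The support of a chain is one equicontinuous family, so a single exponent serves all its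
simplices, even if they are infinitely many. -/
theorem exists_pushChain_sdIter_mem {n : ℕ} {ε : ℝ} (h𝒰 : HasLebesgueNumber 𝒰 ε)
    (hε : 0 < ε) (c : UBChain A X n) :
    ∃ m, pushChain A (AffineChain.sdIter n m) c ∈ smallChains A X 𝒰 n := by
  obtain ⟨M, hM⟩ := exists_isSmall_of_diamLE h𝒰 hε c.2.1.equicontinuous
  refine ⟨M, ?_⟩
  have h := AffineChain.sdIter_mem_supportedIn n M
  rw [pushChain, AffineChain.lift_eq_sum, AddMonoidHom.finsetSum_apply]
  refine sum_mem fun v hv => ?_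
  rw [AddMonoidHom.smul_apply]
  refine AddSubgroup.zsmul_mem _ ?_ _
  refine fun σ hσ => push_eq_zero _ fun τ hτ => ?_
  by_contra hne
  exact hσ (hτ ▸ hM M le_rfl v (h v hv) ⟨τ, hne⟩)

theorem sub_pushChain_sd {n : ℕ} (c : UBChain A X (n + 1)) :
    c - pushChain A (AffineChain.sd (n + 1)) c =
      boundary A X (n + 1) (pushChain A (AffineChain.sdHomotopy (n + 1)) c) +
        pushChain A (AffineChain.sdHomotopy n) (boundary A X n c) := by
  have h := AffineChain.bd_comp_sdHomotopy n
  rw [eq_sub_iff_add_eq] at h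
  rw [boundary_eq_pushChain, boundary_eq_pushChain, ← pushChain_comp, ← pushChain_comp,
    ← AddMonoidHom.add_apply, ← map_add, h, map_sub, AddMonoidHom.sub_apply, pushChain_id]

/-- Each subdivision changes `c` by a boundary plus the homotopy applied to `∂c`. The latter is
small because affine operations preserve smallness. -/
theorem exists_sub_sdIter_mem_smallChains {n : ℕ} (m : ℕ) (c : UBChain A X (n + 1))
    (hc : boundary A X n c ∈ smallChains A X 𝒰 n) :
    ∃ b, c - boundary A X (n + 1) b - pushChain A (AffineChain.sdIter (n + 1) m) c ∈
      smallChains A X 𝒰 (n + 1) := by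
  induction m generalizing c with
  | zero =>
    refine ⟨0, ?_⟩
    rw [AffineChain.sdIter_zero, pushChain_id, map_zero, sub_zero, sub_self]
    exact zero_mem _
  | succ m ih =>
    obtain ⟨b, hb⟩ := ih (pushChain A (AffineChain.sd (n + 1)) c) (by
      rw [boundary_eq_pushChain] at hc ⊢
      rw [← pushChain_comp, AffineChain.bd_comp_sd, pushChain_comp]
      exact pushChain_mem_smallChains _ hc)
    refine ⟨b + pushChain A (AffineChain.sdHomotopy (n + 1)) c, ?_⟩
    rw [AffineChain.sdIter_succ', pushChain_comp]
    have h := add_mem hb (pushChain_mem_smallChains (AffineChain.sdHomotopy n) hc)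
    have e := sub_pushChain_sd c
    rw [sub_eq_iff_eq_add] at e
    convert h using 1
    rw [map_add]
    nth_rewrite 1 [e]
    abel

/-- The inclusion of the complex of small chains has acyclic cokernel. -/
theorem exists_sub_boundary_mem_smallChains {n : ℕ} {ε : ℝ} (h𝒰 : HasLebesgueNumber 𝒰 ε)
    (hε : 0 < ε) (c : UBChain A X (n + 1)) (hc : boundary A X n c ∈ smallChains A X 𝒰 n) :
    ∃ b, c - boundary A X (n + 1) b ∈ smallChains A X 𝒰 (n + 1) := by
  obtain ⟨m, hm⟩ := exists_pushChain_sdIter_mem h𝒰 hε c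
  obtain ⟨b, hb⟩ := exists_sub_sdIter_mem_smallChains m c hc
  refine ⟨b, ?_⟩
  have := add_mem hb hm
  rwa [sub_add_cancel] at this

end ChainAction

/-! ### Extension and restriction along isometric embeddings -/

section Isometries

variable {X Y : Type u} [MetricSpace X] [MetricSpace Y] {f : EPUC Y X}

theorem EPUC.isometry_subspace (S : Set X) : Isometry (EPUC.subspace S).toFun :=
  isometry_subtype_coe

theorem EPUC.isometry_inclusion {S T : Set X} (h : S ⊆ T) : Isometry (EPUC.inclusion h).toFun :=
  fun _ _ => rfl

theorem mapSimplex_injective (hf : Isometry f.toFun) (n : ℕ) :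
    Function.Injective (f.mapSimplex n) := fun σ τ h => by
  ext x
  exact hf.injective (DFunLike.congr_fun h x)

/-- The pointwise lift is continuous because an isometry is an embedding. -/
theorem mem_range_mapSimplex (hf : Isometry f.toFun) {n : ℕ} {σ : Simplex n X} :
    σ ∈ range (f.mapSimplex n) ↔ range σ ⊆ range f.toFun := by
  constructor
  · rintro ⟨τ, rfl⟩
    exact range_comp_subset_range τ f.toFun
  · intro h
    choose g hg using fun x => h ⟨x, rfl⟩
    refine ⟨⟨g, hf.isEmbedding.continuous_iff.2 ?_⟩, ?_⟩
    · rw [show f.toFun ∘ g = σ from funext hg]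
      exact σ.continuous
    · ext x
      exact hg x

theorem mem_range_mapSimplex_subspace {S : Set X} {n : ℕ} {σ : Simplex n X} :
    σ ∈ range ((EPUC.subspace S).mapSimplex n) ↔ range σ ⊆ S := by
  rw [mem_range_mapSimplex (EPUC.isometry_subspace S)]
  change range σ ⊆ range (Subtype.val : S → X) ↔ _
  rw [Subtype.range_coe]

/-- Isometries reflect uniform families. -/
theorem IsUniformFamily.of_mapSimplex (hf : Isometry f.toFun) {n : ℕ} {ι : Type*}
    {τ : ι → Simplex n Y} (h : IsUniformFamily fun i => f.mapSimplex n (τ i)) :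
    IsUniformFamily τ where
  locallyFinite r hr := by
    obtain ⟨K, hK⟩ := h.locallyFinite r hr
    refine ⟨K, fun y => le_trans (encard_le_encard ?_) (hK (f.toFun y))⟩
    rintro i ⟨_, hz, ⟨z, rfl⟩⟩
    refine ⟨f.toFun (τ i z), ?_, ⟨z, rfl⟩⟩
    rw [Metric.mem_ball, hf.dist_eq]
    exact hz
  equicontinuous :=
    (hf.isUniformInducing.equicontinuous_iff (F := fun i => (τ i : _ → Y))).2 h.equicontinuous

variable {A : Type v} [SeminormedAddCommGroup A]

/-- Extension by zero of a cochain on a subspace. -/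
def extendCochain (hf : Isometry f.toFun) {n : ℕ} (w : UBCochain A Y n) : UBCochain A X n :=
  ⟨Function.extend (f.mapSimplex n) w.1 0, fun ι σ hσ => by
    choose τ hτ using fun i : {i // σ i ∈ range (f.mapSimplex n)} => i.2
    -- The extension can be nonzero only on members coming from `Y`, and these form a uniform family
    -- of `Y`.
    have h : IsUniformFamily τ := by
      refine .of_mapSimplex hf ?_
      rw [show (fun i => f.mapSimplex n (τ i)) = σ ∘ Subtype.val from funext hτ]
      exact hσ.comp_injective Subtype.val_injective
    obtain ⟨C, hC⟩ := UBCochain.bounded w h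
    refine ⟨max C 0, fun i => ?_⟩
    by_cases hi : σ i ∈ range (f.mapSimplex n)
    · rw [← hτ ⟨i, hi⟩, (mapSimplex_injective hf n).extend_apply]
      exact (hC _).trans (le_max_left _ _)
    · rw [Function.extend_apply' _ _ _ hi]
      simp⟩

theorem extendCochain_mapSimplex (hf : Isometry f.toFun) {n : ℕ} (w : UBCochain A Y n)
    (τ : Simplex n Y) : (extendCochain hf w).1 (f.mapSimplex n τ) = w.1 τ :=
  (mapSimplex_injective hf n).extend_apply _ _ _

theorem extendCochain_of_notMem (hf : Isometry f.toFun) {n : ℕ} (w : UBCochain A Y n)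
    {σ : Simplex n X} (h : σ ∉ range (f.mapSimplex n)) : (extendCochain hf w).1 σ = 0 :=
  Function.extend_apply' _ _ _ h

theorem pull_extendCochain (hf : Isometry f.toFun) {n : ℕ} (w : UBCochain A Y n) :
    pull A (f.mapSimplex n) (preservesUniform_map f n) (extendCochain hf w) = w := by
  ext τ
  exact extendCochain_mapSimplex hf w τ

/-- The part of a chain that lies in a subspace. -/
def restrictChain (hf : Isometry f.toFun) {n : ℕ} (c : UBChain A X n) : UBChain A Y n :=
  ⟨fun τ => c.1 (f.mapSimplex n τ), by
    refine .of_mapSimplex hf ?_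
    exact c.2.1.comp_injective (g := fun τ : Function.support fun τ => c.1 (f.mapSimplex n τ) =>
      (⟨f.mapSimplex n τ, τ.2⟩ : Function.support c.1)) fun τ τ' h =>
        Subtype.ext (mapSimplex_injective hf n (congrArg Subtype.val h)), by
    obtain ⟨C, hC⟩ := c.2.2
    exact ⟨C, fun τ => hC _⟩⟩

theorem push_mapSimplex (hf : Isometry f.toFun) {n : ℕ} (c : UBChain A Y n) (τ : Simplex n Y) :
    (push A (f.mapSimplex n) (preservesUniform_map f n) c).1 (f.mapSimplex n τ) = c.1 τ := by
  change ∑ᶠ s ∈ f.mapSimplex n ⁻¹' {f.mapSimplex n τ}, c.1 s = _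
  rw [show f.mapSimplex n ⁻¹' {f.mapSimplex n τ} = {τ} by
    ext s
    exact (mapSimplex_injective hf n).eq_iff, finsum_mem_singleton]

theorem push_of_notMem {n : ℕ} (c : UBChain A Y n) {σ : Simplex n X}
    (h : σ ∉ range (f.mapSimplex n)) :
    (push A (f.mapSimplex n) (preservesUniform_map f n) c).1 σ = 0 :=
  push_eq_zero _ fun s hs => absurd ⟨s, hs⟩ h

theorem push_injective (hf : Isometry f.toFun) (n : ℕ) :
    Function.Injective (push A (f.mapSimplex n) (preservesUniform_map f n)) := fun a b h => by
  ext τ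
  rw [← push_mapSimplex hf a, h, push_mapSimplex hf]

theorem push_restrictChain (hf : Isometry f.toFun) {n : ℕ} {c : UBChain A X n}
    (hc : ∀ σ, σ ∉ range (f.mapSimplex n) → c.1 σ = 0) :
    push A (f.mapSimplex n) (preservesUniform_map f n) (restrictChain hf c) = c := by
  ext σ
  by_cases h : σ ∈ range (f.mapSimplex n)
  · obtain ⟨τ, rfl⟩ := h
    exact push_mapSimplex hf _ τ
  · rw [push_of_notMem _ h, hc σ h]

/-- The cochains vanishing on small simplices with respect to a two-element cover. -/
theorem mem_nullCochains_pair {U V : Set X} {n : ℕ} {w : UBCochain A X n} :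
    w ∈ nullCochains A X {U, V} n ↔
      pull A ((EPUC.subspace U).mapSimplex n) (preservesUniform_map _ n) w = 0 ∧
      pull A ((EPUC.subspace V).mapSimplex n) (preservesUniform_map _ n) w = 0 := by
  constructor
  · intro h
    constructor
    · ext τ
      exact h _ ⟨U, Or.inl rfl, mem_range_mapSimplex_subspace.1 ⟨τ, rfl⟩⟩
    · ext τ
      exact h _ ⟨V, Or.inr rfl, mem_range_mapSimplex_subspace.1 ⟨τ, rfl⟩⟩
  · rintro ⟨hU, hV⟩ σ ⟨W, rfl | rfl, hσ⟩
    · obtain ⟨τ, rfl⟩ := mem_range_mapSimplex_subspace.2 hσ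
      exact congrArg (fun z => z.1 τ) hU
    · obtain ⟨τ, rfl⟩ := mem_range_mapSimplex_subspace.2 hσ
      exact congrArg (fun z => z.1 τ) hV

theorem push_push_mapSimplex {Z : Type u} [MetricSpace Z] {f : EPUC Y X} {g : EPUC Z Y}
    {k : EPUC Z X} (h : ∀ z, f.toFun (g.toFun z) = k.toFun z) {n : ℕ} (c : UBChain A Z n) :
    push A (f.mapSimplex n) (preservesUniform_map f n)
      (push A (g.mapSimplex n) (preservesUniform_map g n) c) =
      push A (k.mapSimplex n) (preservesUniform_map k n) c := by
  have e : f.mapSimplex n ∘ g.mapSimplex n = k.mapSimplex n := by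
    ext σ x
    exact h (σ x)
  have hk := preservesUniform_map k n
  rw [← e] at hk
  rw [← AddMonoidHom.comp_apply, push_comp A _ _ hk]
  congr 2

/-- The small chains with respect to a two-element cover. -/
theorem mem_smallChains_pair {U V : Set X} {n : ℕ} {c : UBChain A X n} :
    c ∈ smallChains A X {U, V} n ↔ ∃ a b,
      c = push A ((EPUC.subspace U).mapSimplex n) (preservesUniform_map _ n) a -
        push A ((EPUC.subspace V).mapSimplex n) (preservesUniform_map _ n) b := by
  constructor
  · intro h
    -- `a` is the part of `c` in `U`, and `b` is that part minus `c`. The latter lives in `V`: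
    -- coefficients cancel on simplices in `U`, and a simplex in neither set is not small.
    refine ⟨restrictChain (EPUC.isometry_subspace U) c,
      restrictChain (EPUC.isometry_subspace V) (push A ((EPUC.subspace U).mapSimplex n)
        (preservesUniform_map _ n) (restrictChain (EPUC.isometry_subspace U) c) - c), ?_⟩
    rw [push_restrictChain (EPUC.isometry_subspace V), sub_sub_cancel]
    intro σ hσ
    change (push A _ _ _).1 σ - c.1 σ = 0
    by_cases hU : σ ∈ range ((EPUC.subspace U).mapSimplex n)
    · obtain ⟨τ, rfl⟩ := hU
      rw [push_mapSimplex (EPUC.isometry_subspace U)]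
      exact sub_self _
    · rw [push_of_notMem _ hU, zero_sub, neg_eq_zero]
      refine h _ ?_
      rintro ⟨W, rfl | rfl, hW⟩
      · exact hU (mem_range_mapSimplex_subspace.2 hW)
      · exact hσ (mem_range_mapSimplex_subspace.2 hW)
  · rintro ⟨a, b, rfl⟩ σ hσ
    change (push A _ _ a).1 σ - (push A _ _ b).1 σ = 0
    rw [push_of_notMem, push_of_notMem, sub_zero]
    · exact fun h => hσ ⟨V, Or.inr rfl, mem_range_mapSimplex_subspace.1 h⟩
    · exact fun h => hσ ⟨U, Or.inl rfl, mem_range_mapSimplex_subspace.1 h⟩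

end Isometries

/-! ### The acyclicity statements in all degrees -/

section Complexes

variable {A : Type v} [SeminormedAddCommGroup A] {X Y : Type u} [MetricSpace X] [MetricSpace Y]

theorem ubCochainComplex_d_apply {n : ℕ} (w : UBCochain A X n) :
    (ubCochainComplex A X).d n (n + 1) w = coboundary A X n w := by
  rw [ubCochainComplex_d]
  rfl

theorem ubChainComplex_d_apply {n : ℕ} (c : UBChain A X (n + 1)) :
    (ubChainComplex A X).d (n + 1) n c = boundary A X n c := by
  rw [ubChainComplex_d]
  rfl

/-- The complex of cochains vanishing on small simplices is acyclic. -/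
theorem exists_null_d_eq {𝒰 : Set (Set X)} {ε : ℝ} (h𝒰 : HasLebesgueNumber 𝒰 ε) (hε : 0 < ε)
    {h i j : ℕ} (hi : (ComplexShape.up ℕ).prev i = h) (hj : (ComplexShape.up ℕ).next i = j)
    {w : UBCochain A X i} (hw : w ∈ nullCochains A X 𝒰 i)
    (hdw : (ubCochainComplex A X).d i j w = 0) :
    ∃ v ∈ nullCochains A X 𝒰 h, (ubCochainComplex A X).d h i v = w := by
  cases i with
  | zero =>
    -- Points are small, so a null cochain of degree zero is zero.
    refine ⟨0, zero_mem _, (map_zero _).trans ?_⟩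
    refine Subtype.ext (funext fun σ => ?_)
    exact (hw σ (isSmall_zero h𝒰 hε σ)).symm
  | succ n =>
    obtain rfl : n = h := (CochainComplex.prev_nat_succ n).symm.trans hi
    obtain rfl : n + 1 + 1 = j := (CochainComplex.next ℕ (n + 1)).symm.trans hj
    rw [ubCochainComplex_d_apply] at hdw
    obtain ⟨v, hv, h⟩ := exists_null_coboundary_eq h𝒰 hε hw hdw
    exact ⟨v, hv, (ubCochainComplex_d_apply v).trans h⟩

/-- The inclusion of the complex of small chains has acyclic cokernel. -/
theorem exists_sub_d_mem_smallChains {𝒰 : Set (Set X)} {ε : ℝ} (h𝒰 : HasLebesgueNumber 𝒰 ε)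
    (hε : 0 < ε) {h i j : ℕ} (hi : (ComplexShape.down ℕ).prev i = h)
    (hj : (ComplexShape.down ℕ).next i = j) {c : (ubChainComplex A X).X i}
    (hc : (ubChainComplex A X).d i j c ∈ smallChains A X 𝒰 j) :
    ∃ (b : (ubChainComplex A X).X h) (s : (ubChainComplex A X).X i), s ∈ smallChains A X 𝒰 i ∧
      c = (ubChainComplex A X).d h i b + s := by
  obtain rfl : i + 1 = h := (ChainComplex.prev ℕ i).symm.trans hi
  cases i with
  | zero =>
    -- Points are small, so every chain of degree zero is small already.
    refine ⟨0, c, fun σ hσ => absurd (isSmall_zero h𝒰 hε σ) hσ, ?_⟩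
    rw [map_zero, zero_add]
  | succ n =>
    obtain rfl : n = j := (ChainComplex.next_nat_succ n).symm.trans hj
    obtain ⟨b, hb⟩ := exists_sub_boundary_mem_smallChains h𝒰 hε c fun σ hσ =>
      (congrArg (fun z : UBChain A X n => z.1 σ) (ubChainComplex_d_apply c)).symm.trans (hc σ hσ)
    refine ⟨b, _, hb, ?_⟩
    rw [ubChainComplex_d_apply]
    exact (add_sub_cancel (boundary A X (n + 1) b) c).symm

end Complexes

/-! ### The two Mayer-Vietoris squares -/

section MainResults

variable (A : Type v) [SeminormedAddCommGroup A] {X : Type u} [MetricSpace X]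

/-- Extension by zero gives gluing and surjectivity onto the cochains of the intersection; only
acyclicity of the kernel needs subdivision. -/
theorem isMayerVietorisSquare_ubCochainMap {U V : Set X} {ε : ℝ} (hε : 0 < ε)
    (h : HasLebesgueNumber {U, V} ε) :
    IsMayerVietorisSquare (ubCochainMap A (EPUC.subspace U)) (ubCochainMap A (EPUC.subspace V))
      (ubCochainMap A (EPUC.inclusion (inter_subset_left : U ∩ V ⊆ U)))
      (ubCochainMap A (EPUC.inclusion (inter_subset_right : U ∩ V ⊆ V))) where
  comm i p := rfl
  exact_middle i q q' hq := by
    let q₁ : UBCochain A U i := q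
    let q₂ : UBCochain A V i := q'
    have hUV : ∀ τ : Simplex i ↥(U ∩ V), q₁.1 ((EPUC.inclusion inter_subset_left).mapSimplex i τ) =
        q₂.1 ((EPUC.inclusion inter_subset_right).mapSimplex i τ) := fun τ =>
      congrArg (fun z : UBCochain A ↥(U ∩ V) i => z.1 τ) hq
    have hU := EPUC.isometry_subspace U
    have hV := EPUC.isometry_subspace V
    -- `e` is the correction on `V` after extending `q₁` by zero. It vanishes on simplices in the
    -- intersection, where `q₁` and `q₂` agree, so adding its extension does not disturb the values
    -- on `U`.
    let e : UBCochain A V i := q₂ - pull A ((EPUC.subspace V).mapSimplex i)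
      (preservesUniform_map _ i) (extendCochain hU q₁)
    refine ⟨(extendCochain hU q₁ + extendCochain hV e : UBCochain A X i), ?_, ?_⟩
    · refine Subtype.ext (funext fun τ => ?_)
      change (extendCochain hU q₁).1 _ + (extendCochain hV e).1 _ = q₁.1 τ
      rw [extendCochain_mapSimplex, add_eq_left]
      by_cases hτ : (EPUC.subspace U).mapSimplex i τ ∈ range ((EPUC.subspace V).mapSimplex i)
      · have hr := subset_inter (mem_range_mapSimplex_subspace.1 ⟨τ, rfl⟩)
          (mem_range_mapSimplex_subspace.1 hτ)
        obtain ⟨ρ, hρ⟩ := mem_range_mapSimplex_subspace.2 hr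
        obtain rfl : (EPUC.inclusion inter_subset_left).mapSimplex i ρ = τ :=
          mapSimplex_injective hU i hρ
        change (extendCochain hV e).1 ((EPUC.subspace V).mapSimplex i
          ((EPUC.inclusion inter_subset_right).mapSimplex i ρ)) = 0
        rw [extendCochain_mapSimplex]
        change q₂.1 _ - (extendCochain hU q₁).1 ((EPUC.subspace U).mapSimplex i
          ((EPUC.inclusion inter_subset_left).mapSimplex i ρ)) = 0
        rw [extendCochain_mapSimplex, hUV, sub_self]
      · exact extendCochain_of_notMem hV e hτ
    · refine Subtype.ext (funext fun τ => ?_)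
      change (extendCochain hU q₁).1 _ + (extendCochain hV e).1 _ = q₂.1 τ
      rw [extendCochain_mapSimplex]
      exact add_sub_cancel _ _
  acyclic_ker h' i j hi hj p hp hp' hdp := by
    obtain ⟨v, hv, hvp⟩ := exists_null_d_eq h hε hi hj (mem_nullCochains_pair.2 ⟨hp, hp'⟩) hdp
    obtain ⟨hv1, hv2⟩ := mem_nullCochains_pair.1 hv
    exact ⟨v, hv1, hv2, hvp⟩
  acyclic_coker h' i j hi hj r q q' hr := by
    refine ⟨0, (extendCochain (EPUC.isometry_inclusion inter_subset_left) r : UBCochain A U i), 0,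
      ?_⟩
    rw [map_zero, map_zero, sub_zero, zero_add]
    exact (pull_extendCochain _ _).symm

/-- Dually, push-forward along an inclusion is injective, so the kernel is zero and only the
cokernel, chains modulo small chains, needs subdivision. -/
theorem isMayerVietorisSquare_ubChainMap {U V : Set X} {ε : ℝ} (hε : 0 < ε)
    (h : HasLebesgueNumber {U, V} ε) :
    IsMayerVietorisSquare (ubChainMap A (EPUC.inclusion (inter_subset_left : U ∩ V ⊆ U)))
      (ubChainMap A (EPUC.inclusion (inter_subset_right : U ∩ V ⊆ V)))
      (ubChainMap A (EPUC.subspace U)) (ubChainMap A (EPUC.subspace V)) where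
  comm i p :=
    (push_push_mapSimplex (k := EPUC.subspace (U ∩ V)) (fun _ => rfl) p).trans
      (push_push_mapSimplex (fun _ => rfl) p).symm
  exact_middle i q q' hq := by
    have hU := EPUC.isometry_subspace U
    have hV := EPUC.isometry_subspace V
    have hUV := EPUC.isometry_subspace (U ∩ V)
    let c : UBChain A X i := (ubChainMap A (EPUC.subspace U)).f i q
    -- The common image `c` has coefficient zero at each simplex leaving `U` or leaving `V`, so it
    -- comes from the intersection.
    have hc : push A ((EPUC.subspace (U ∩ V)).mapSimplex i) (preservesUniform_map _ i)
        (restrictChain hUV c) = c := by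
      refine push_restrictChain hUV fun σ hσ => ?_
      rw [mem_range_mapSimplex_subspace, subset_inter_iff, not_and_or] at hσ
      rcases hσ with hσ | hσ
      · exact push_of_notMem _ fun h => hσ (mem_range_mapSimplex_subspace.1 h)
      · have : c = (ubChainMap A (EPUC.subspace V)).f i q' := hq
        rw [this]
        exact push_of_notMem _ fun h => hσ (mem_range_mapSimplex_subspace.1 h)
    refine ⟨restrictChain hUV c, push_injective hU i ?_, push_injective hV i ?_⟩
    · exact (push_push_mapSimplex (fun _ => rfl) _).trans hc
    · exact (push_push_mapSimplex (fun _ => rfl) _).trans (hc.trans hq)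
  acyclic_ker h' i j hi hj p hp hp' hdp := by
    have : p = 0 := push_injective (EPUC.isometry_inclusion inter_subset_left) i
      (hp.trans (map_zero _).symm)
    exact ⟨0, map_zero _, map_zero _, by rw [this, map_zero]⟩
  acyclic_coker h' i j hi hj r q q' hr := by
    obtain ⟨b, s, hs, hrs⟩ := exists_sub_d_mem_smallChains h hε hi hj (c := r)
      (mem_smallChains_pair.2 ⟨q, q', hr⟩)
    obtain ⟨a, a', ha⟩ := mem_smallChains_pair.1 hs
    refine ⟨b, a, a', hrs.trans ?_⟩
    rw [ha]
    rfl

/-! ### Relative complexes and excision -/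

section Excision

/-- The inclusion of the relative cochains into the cochains. -/
def relCochainι (S : Set X) : relCochainComplex A S ⟶ ubCochainComplex A X :=
  kernel.ι (ubCochainMap A (EPUC.subspace S))

/-- The projection from the chains to the relative chains. -/
def relChainπ (S : Set X) : ubChainComplex A X ⟶ relChainComplex A S :=
  cokernel.π (ubChainMap A (EPUC.subspace S))

theorem relCochainι_injective (S : Set X) (i : ℕ) : Function.Injective ((relCochainι A S).f i) :=
  (AddCommGrpCat.mono_iff_injective _).1
    (inferInstanceAs (Mono ((kernel.ι (ubCochainMap A (EPUC.subspace S))).f i)))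

/-- Evaluation in a degree is an exact functor, so the kernel of complexes is computed degreewise.
-/
theorem relCochainι_exact (S : Set X) (i : ℕ) :
    Function.Exact ((relCochainι A S).f i) ((ubCochainMap A (EPUC.subspace S)).f i) := by
  have h : (ShortComplex.mk _ _ (kernel.condition (ubCochainMap A (EPUC.subspace S)))).Exact :=
    ShortComplex.exact_of_f_is_kernel _ (kernelIsKernel _)
  exact (ShortComplex.ab_exact_iff_function_exact _).1 (h.map (HomologicalComplex.eval _ _ i))

theorem relChainπ_surjective (S : Set X) (i : ℕ) : Function.Surjective ((relChainπ A S).f i) :=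
  (AddCommGrpCat.epi_iff_surjective _).1
    (inferInstanceAs (Epi ((cokernel.π (ubChainMap A (EPUC.subspace S))).f i)))

theorem relChainπ_exact (S : Set X) (i : ℕ) :
    Function.Exact ((ubChainMap A (EPUC.subspace S)).f i) ((relChainπ A S).f i) := by
  have h : (ShortComplex.mk _ _ (cokernel.condition (ubChainMap A (EPUC.subspace S)))).Exact :=
    ShortComplex.exact_of_g_is_cokernel _ (cokernelIsCokernel _)
  exact (ShortComplex.ab_exact_iff_function_exact _).1 (h.map (HomologicalComplex.eval _ _ i))

/-- A set of diameter less than `ε` that meets `Z` lies in the `ε`-neighbourhood of `Z`. -/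
theorem hasLebesgueNumber_compl {Y Z : Set X} {ε : ℝ} (hε : 0 < ε)
    (h : Metric.thickening ε Z ⊆ Y) : HasLebesgueNumber {Zᶜ, Y} ε := by
  intro S hS
  by_cases hZ : ∃ z ∈ S, z ∈ Z
  · obtain ⟨z, hzS, hz⟩ := hZ
    refine ⟨Y, Or.inr rfl, fun x hx => h (Metric.mem_thickening_iff.2 ⟨z, hz, ?_⟩)⟩
    have := (Metric.edist_le_ediam_of_mem hx hzS).trans_lt hS
    rwa [edist_dist, ENNReal.ofReal_lt_ofReal_iff hε] at this
  · exact ⟨Zᶜ, Or.inl rfl, fun x hx hz => hZ ⟨x, hx, hz⟩⟩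

theorem relCochainι_relCochainMap {Y : Type u} [MetricSpace Y] (f : EPUC X Y) {S : Set X}
    {T : Set Y} (h : MapsTo f.toFun S T) {n : ℕ} (x : (relCochainComplex A T).X n) :
    (relCochainι A S).f n ((relCochainMap A f h).f n x) =
      (ubCochainMap A f).f n ((relCochainι A T).f n x) := by
  have e : relCochainMap A f h ≫ relCochainι A S = relCochainι A T ≫ ubCochainMap A f :=
    kernel.lift_ι _ _ _
  exact ConcreteCategory.congr_hom (congrArg (fun φ => φ.f n) e) x

theorem relChainMap_relChainπ {Y : Type u} [MetricSpace Y] (f : EPUC X Y) {S : Set X} {T : Set Y}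
    (h : MapsTo f.toFun S T) {n : ℕ} (x : (ubChainComplex A X).X n) :
    (relChainMap A f h).f n ((relChainπ A S).f n x) =
      (relChainπ A T).f n ((ubChainMap A f).f n x) := by
  have e : relChainπ A S ≫ relChainMap A f h = ubChainMap A f ≫ relChainπ A T :=
    cokernel.π_desc _ _ _
  exact ConcreteCategory.congr_hom (congrArg (fun φ => φ.f n) e) x

/-- Excision in cohomology. -/
theorem relCohomologyMap_bijective {Y Z : Set X} {ε : ℝ} (hε : 0 < ε)
    (h : Metric.thickening ε Z ⊆ Y) (n : ℕ) :
    Function.Bijective (relCohomologyMap A (EPUC.subspace Zᶜ) (mapsTo_removed Y Z) n) := by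
  refine homologyMap_bijective_of_surjective _ (fun i y => ?_) fun i z hz hdz => ?_
  · let w : UBCochain A ↥Zᶜ i := (relCochainι A (removed Y Z)).f i y
    have hw : ∀ τ, w.1 ((EPUC.subspace (removed Y Z)).mapSimplex i τ) = 0 := fun τ =>
      congrArg (fun z : UBCochain A (removed Y Z) i => z.1 τ)
        ((relCochainι_exact A (removed Y Z) i).apply_apply_eq_zero y)
    have hZ := EPUC.isometry_subspace Zᶜ
    -- The extension by zero is again a relative cochain: a simplex of `Y` either meets `Z`, where
    -- the extension is zero, or lies in `Y - Z`, where `w` vanishes.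
    have key : (ubCochainMap A (EPUC.subspace Y)).f i (extendCochain hZ w) = 0 := by
      refine Subtype.ext (funext fun τ => ?_)
      change (extendCochain hZ w).1 ((EPUC.subspace Y).mapSimplex i τ) = 0
      by_cases hτ : (EPUC.subspace Y).mapSimplex i τ ∈ range ((EPUC.subspace Zᶜ).mapSimplex i)
      · obtain ⟨ρ, hρ⟩ := hτ
        have hr : range ρ ⊆ removed Y Z := by
          rintro _ ⟨x, rfl⟩
          have := DFunLike.congr_fun hρ x
          change (ρ x : X) ∈ Y
          rw [show (ρ x : X) = (τ x : X) from this]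
          exact (τ x).2
        obtain ⟨ρ', rfl⟩ := mem_range_mapSimplex_subspace.2 hr
        rw [← hρ, extendCochain_mapSimplex, hw]
      · exact extendCochain_of_notMem hZ w hτ
    obtain ⟨x, hx⟩ := (relCochainι_exact A Y i _).1 key
    refine ⟨x, relCochainι_injective A _ i ?_⟩
    rw [relCochainι_relCochainMap, hx]
    exact pull_extendCochain hZ w
  · let K := relCochainι A Y
    have h1 : (ubCochainMap A (EPUC.subspace Zᶜ)).f i (K.f i z) = 0 := by
      rw [← relCochainι_relCochainMap A (EPUC.subspace Zᶜ) (mapsTo_removed Y Z), hz, map_zero]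
    have h2 : (ubCochainMap A (EPUC.subspace Y)).f i (K.f i z) = 0 :=
      (relCochainι_exact A Y i).apply_apply_eq_zero z
    -- The kernel consists of the cochains vanishing on simplices of `X - Z` and of `Y`, the null
    -- cochains of the cover; the primitive found is again one, hence relative.
    obtain ⟨v, hv, hvz⟩ := exists_null_d_eq (hasLebesgueNumber_compl hε h) hε rfl rfl
      (mem_nullCochains_pair.2 ⟨h1, h2⟩) (by
        refine (d_hom_apply K _ _ z).trans ?_
        rw [hdz, map_zero])
    obtain ⟨hv1, hv2⟩ := mem_nullCochains_pair.1 hv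
    obtain ⟨b, hb⟩ := (relCochainι_exact A Y _ _).1 hv2
    refine ⟨b, relCochainι_injective A _ _ ?_, relCochainι_injective A _ _ ?_⟩
    · rw [relCochainι_relCochainMap, hb, map_zero]
      exact hv1
    · exact (d_hom_apply K _ _ b).symm.trans ((congrArg _ hb).trans hvz)

/-- Excision in homology. -/
theorem relHomologyMap_bijective {Y Z : Set X} {ε : ℝ} (hε : 0 < ε)
    (h : Metric.thickening ε Z ⊆ Y) (n : ℕ) :
    Function.Bijective (relHomologyMap A (EPUC.subspace Zᶜ) (mapsTo_removed Y Z) n) := by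
  refine homologyMap_bijective_of_injective _ (fun i => ?_) fun i z hz => ?_
  · rw [injective_iff_map_eq_zero]
    intro x hx
    obtain ⟨c, rfl⟩ := relChainπ_surjective A _ i x
    rw [relChainMap_relChainπ, relChainπ_exact A Y i _] at hx
    obtain ⟨b, hb⟩ := hx
    rw [relChainπ_exact A (removed Y Z) i _]
    refine ⟨restrictChain (EPUC.isometry_subspace (removed Y Z)) c, push_restrictChain _ ?_⟩
    intro τ hτ
    let c' : UBChain A ↥Zᶜ i := c
    -- A chain of `X - Z` that is also a chain of `Y` has no coefficient at a simplex leaving `Y`,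
    -- so it comes from `Y - Z`.
    have e : (push A ((EPUC.subspace Zᶜ).mapSimplex i) (preservesUniform_map _ i) c').1
        ((EPUC.subspace Zᶜ).mapSimplex i τ) = 0 := by
      refine (congrArg (fun z : UBChain A X i => z.1 _) hb).symm.trans ?_
      refine push_of_notMem _ fun hr => hτ (mem_range_mapSimplex_subspace.2 ?_)
      rintro _ ⟨x, rfl⟩
      exact mem_range_mapSimplex_subspace.1 hr ⟨x, rfl⟩
    rwa [push_mapSimplex (EPUC.isometry_subspace Zᶜ)] at e
  · obtain ⟨r, rfl⟩ := relChainπ_surjective A _ i z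
    obtain ⟨x, hx⟩ := hz
    obtain ⟨c, rfl⟩ := relChainπ_surjective A _ _ x
    rw [relChainMap_relChainπ, d_hom_apply, ← sub_eq_zero, ← map_sub, relChainπ_exact A Y _ _] at hx
    obtain ⟨b, hb⟩ := hx
    have hr : (ubChainComplex A X).d i _ r = (ubChainMap A (EPUC.subspace Zᶜ)).f _ c -
        (ubChainMap A (EPUC.subspace Y)).f _ b := by rw [hb, sub_sub_cancel]
    -- A boundary coming from `X - Z` modulo `Y` is a small chain. So `r` is small up to a boundary,
    -- and the part `a'` in `Y` of the small chain dies in the quotient.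
    obtain ⟨b', s, hs, hrs⟩ := exists_sub_d_mem_smallChains (hasLebesgueNumber_compl hε h) hε rfl
      rfl (c := r) (mem_smallChains_pair.2 ⟨c, b, hr⟩)
    obtain ⟨a, a', ha⟩ := mem_smallChains_pair.1 hs
    refine ⟨(relChainπ A Y).f _ b',
      (relChainπ A (removed Y Z)).f i a, ?_⟩
    refine (relChainMap_relChainπ A _ _ _).trans ?_
    rw [d_hom_apply, ← map_sub, ← sub_eq_zero, ← map_sub, relChainπ_exact A Y i _]
    refine ⟨a', ?_⟩
    rw [hrs, add_sub_cancel_left, ha]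
    exact (sub_sub_cancel _ _).symm

end Excision

end MainResults

end UniformBounded

end

theorem mainTheorem11 (X : Type u) [MetricSpace X] (A : Type v) [SeminormedAddCommGroup A] :
    -- the Mayer-Vietoris sequence in cohomology
    (∀ (U V : Set X) (ε : ℝ), 0 < ε → U ∪ V = Set.univ → HasLebesgueNumber {U, V} ε →
      ∃ d : ∀ n, ubCohomology A ↥(U ∩ V) n →+ ubCohomology A X (n + 1),
        Function.Injective (mvRestrict A U V 0) ∧
        (∀ n, Function.Exact (mvRestrict A U V n) (mvRestrictDiff A U V n)) ∧
        (∀ n, Function.Exact (mvRestrictDiff A U V n) (d n)) ∧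
        (∀ n, Function.Exact (d n) (mvRestrict A U V (n + 1)))) ∧
    -- excision in cohomology
    (∀ (Y Z : Set X) (ε : ℝ), 0 < ε → Z ⊆ Y → Metric.thickening ε Z ⊆ Y →
      ∀ n, Function.Bijective
        (relCohomologyMap A (EPUC.subspace Zᶜ) (mapsTo_removed Y Z) n)) ∧
    -- the Mayer-Vietoris sequence in homology
    (∀ (U V : Set X) (ε : ℝ), 0 < ε → U ∪ V = Set.univ → HasLebesgueNumber {U, V} ε →
      ∃ d : ∀ n, ubHomology A X (n + 1) →+ ubHomology A ↥(U ∩ V) n,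
        Function.Surjective (mvExtendDiff A U V 0) ∧
        (∀ n, Function.Exact (mvExtend A U V n) (mvExtendDiff A U V n)) ∧
        (∀ n, Function.Exact (mvExtendDiff A U V (n + 1)) (d n)) ∧
        (∀ n, Function.Exact (d n) (mvExtend A U V n))) ∧
    -- excision in homology
    (∀ (Y Z : Set X) (ε : ℝ), 0 < ε → Z ⊆ Y → Metric.thickening ε Z ⊆ Y →
      ∀ n, Function.Bijective
        (relHomologyMap A (EPUC.subspace Zᶜ) (mapsTo_removed Y Z) n)) := by
  refine ⟨fun U V ε hε _ h => ?_, fun Y Z ε hε _ h n => relCohomologyMap_bijective A hε h n,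
    fun U V ε hε _ h => ?_, fun Y Z ε hε _ h n => relHomologyMap_bijective A hε h n⟩
  · have H := isMayerVietorisSquare_ubCochainMap A hε h
    choose d hd hd' using fun n : ℕ =>
      H.exists_exact_connecting (show (ComplexShape.up ℕ).Rel n (n + 1) from rfl)
    -- No differential enters degree zero of a cochain complex, which gives the initial injection;
    -- dually, in homology none leaves it.
    exact ⟨d, H.injective_of_not_rel (by simp), H.exact_homology_middle, hd, hd'⟩
  · have H := isMayerVietorisSquare_ubChainMap A hε h
    choose d hd hd' using fun n : ℕ =>
      H.exists_exact_connecting (show (ComplexShape.down ℕ).Rel (n + 1) n from rfl)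
    exact ⟨d, H.surjective_of_not_rel (by simp), H.exact_homology_middle, hd, hd'⟩
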